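/- Let $Y$ be a complex manifold, $\lambda\in\mathbb{C}$ with $\lambda\neq 0$, and $E$ a $C^\infty$ complex vector bundle of finite rank on $Y$. Let $A^{p,q}(E)$ be the space of $C^\infty$-sections of $\Omega^{p,q}\otimes E$ and $A^{\ell}(E)=\bigoplus_{p+q=\ell}A^{p,q}(E)$. Let $\mathbb{D}^\lambda:A^0(E)\to A^1(E)$ be a flat $\lambda$-connection, i.e. an additive operator with $\mathbb{D}^\lambda(fs)=f\,\mathbb{D}^\lambda(s)+(\lambda\partial_Y f+\overline{\partial}_Y f)\otimes s$ for all $f\in C^\infty(Y)$, $s\in A^0(E)$, and with $\mathbb{D}^\lambda\circ\mathbb{D}^\lambda=0$, where this operator and those below are extended to $A^1(E)\to A^2(E)$ by the Leibniz rule. Write $\mathbb{D}^\lambda=d''_E+d'_E$ for the decomposition into the $(0,1)$-part and the $(1,0)$-part. Let $h$ be a $C^\infty$ Hermitian metric on $E$. Let $\delta'_{E,h}$ be the $(1,0)$-operator such that $d''_E+\delta'_{E,h}$ is the Chern connection, i.e. $\partial h(u,v)=h(\delta'_{E,h}u,v)+h(u,d''_Ev)$, and let $\delta''_{E,h}$ be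 the $(0,1)$-operator determined by $\lambda\,\partial h(u,v)=h(d'_Eu,v)+h(u,\delta''_{E,h}v)$. Put $$\overline{\partial}_{E,h}=\frac{1}{1+|\lambda|^2}\bigl(d''_E+\lambda\,\delta''_{E,h}\bigr),\qquad \theta_{E,h}=\frac{1}{1+|\lambda|^2}\bigl(d'_E-\lambda\,\delta'_{E,h}\bigr),$$ $$\mathbb{D}^{\lambda\star}_{E,h}=\delta'_{E,h}-\delta''_{E,h},\qquad G(h)=\bigl[\mathbb{D}^\lambda,\mathbb{D}^{\lambda\star}_{E,h}\bigr]=\mathbb{D}^\lambda\circ\mathbb{D}^{\lambda\star}_{E,h}+\mathbb{D}^{\lambda\star}_{E,h}\circ\mathbb{D}^\lambda\in A^2(\mathrm{End}(E)),$$ and let $G(h)=G(h)^{2,0}+G(h)^{1,1}+G(h)^{0,2}$ be the decomposition into $(p,q)$-parts. The metric $h$ is called pluri-harmonic if $G(h)=0$. Then: 1. if $G(h)^{1,1}=0$, then $G(h)=0$, i.e. $h$ is pluri-harmonic; 2. $h$ is pluri-harmonic if and only if $G(h)^{1,1}=0$; 3. $h$ is pluri-harmonic if and only if $\overline{\partial}_{E,h}\theta_{E,h}=0$,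 where $\overline{\partial}_{E,h}\theta_{E,h}=[\overline{\partial}_{E,h},\theta_{E,h}]=\overline{\partial}_{E,h}\circ\theta_{E,h}+\theta_{E,h}\circ\overline{\partial}_{E,h}$ is the derivative of the $\mathrm{End}(E)$-valued form $\theta_{E,h}$. -/

import Mathlib

open scoped Manifold ContDiff ComplexConjugate
open Bundle

noncomputable section

set_option linter.unusedSectionVars false

namespace LambdaFlat

/-! ### Real structures underlying complex ones -/

/-- The real manifold underlying a complex manifold. -/
instance (priority := 100) realManifold {V : Type*} [NormedAddCommGroup V] [NormedSpace ℂ V]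
    {Y : Type*} [TopologicalSpace Y] [ChartedSpace V Y] [IsManifold 𝓘(ℂ, V) ω Y] :
    IsManifold 𝓘(ℝ, V) ω Y := by
  refine isManifold_of_contDiffOn _ _ _ fun e e' he he' => ?_
  have := (mem_groupoid_of_pregroupoid.mp
    (HasGroupoid.compatible (G := contDiffGroupoid ω 𝓘(ℂ, V)) he he')).1
  exact ContDiffOn.restrict_scalars ℝ this

instance (priority := 100) realContinuousSMul {M : Type*} [AddCommGroup M] [Module ℂ M]
    [TopologicalSpace M] [ContinuousSMul ℂ M] : ContinuousSMul ℝ M :=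
  IsScalarTower.continuousSMul ℂ

/-- The real vector bundle underlying a complex vector bundle. -/
instance (priority := 100) realVectorBundle {Y : Type*} [TopologicalSpace Y]
    {F : Type*} [NormedAddCommGroup F] [NormedSpace ℂ F]
    {E : Y → Type*} [∀ x, AddCommGroup (E x)] [∀ x, Module ℂ (E x)] [∀ x, TopologicalSpace (E x)]
    [TopologicalSpace (TotalSpace F E)] [FiberBundle F E] [VectorBundle ℂ F E] :
    VectorBundle ℝ F E where
  trivialization_linear' e _ := by
    have h := VectorBundle.trivialization_linear' (R := ℂ) e
    refine ⟨fun b hb => ?_⟩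
    have := h.linear b hb
    exact ⟨this.map_add, fun c x => by
      have := this.map_smul (c : ℂ) x
      simpa using this⟩
  continuousOn_coordChange' e e' _ _ := by
    have h := VectorBundle.continuousOn_coordChange' (R := ℂ) e e'
    have := (ContinuousLinearMap.restrictScalarsL ℂ F F ℝ ℝ).continuous.comp_continuousOn h
    refine this.congr fun b hb => ?_
    ext y
    simp only [Trivialization.coordChangeL]
    classical
    change (dite _ _ _ : F ≃ₗ[ℝ] F) y = (dite _ _ _ : F ≃ₗ[ℂ] F) y
    rw [dif_pos hb, dif_pos hb]
    rfl

/-! ### Types of forms -/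

section Forms

variable {V : Type*} [NormedAddCommGroup V] [NormedSpace ℂ V]
  {Y : Type*} [TopologicalSpace Y] [ChartedSpace V Y]

/-- The complex structure of the (real) tangent space of `Y` at `x`. -/
def tangentJ (x : Y) : TangentSpace 𝓘(ℝ, V) x →L[ℝ] TangentSpace 𝓘(ℝ, V) x :=
  (Complex.I • ContinuousLinearMap.id ℝ V : V →L[ℝ] V)

section
variable {W : Type*} [AddCommGroup W] [Module ℂ W] [TopologicalSpace W]
  [IsTopologicalAddGroup W] [ContinuousSMul ℂ W] {x : Y}

/-- The `(1,0)`-part of a `W`-valued covector: its complex linear part. -/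
def part10 (l : TangentSpace 𝓘(ℝ, V) x →L[ℝ] W) : TangentSpace 𝓘(ℝ, V) x →L[ℝ] W :=
  (1 / 2 : ℂ) • (l - Complex.I • l.comp (tangentJ x))

/-- The `(0,1)`-part of a `W`-valued covector: its conjugate linear part. -/
def part01 (l : TangentSpace 𝓘(ℝ, V) x →L[ℝ] W) : TangentSpace 𝓘(ℝ, V) x →L[ℝ] W :=
  (1 / 2 : ℂ) • (l + Complex.I • l.comp (tangentJ x))

end

/-- `∂f` at `x`, for a complex valued function `f`. -/
def del (f : Y → ℂ) (x : Y) : TangentSpace 𝓘(ℝ, V) x →L[ℝ] ℂ :=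
  part10 (mvfderiv 𝓘(ℝ, V) f x)

/-- `∂̄f` at `x`, for a complex valued function `f`. -/
def delbar (f : Y → ℂ) (x : Y) : TangentSpace 𝓘(ℝ, V) x →L[ℝ] ℂ :=
  part01 (mvfderiv 𝓘(ℝ, V) f x)

section
variable {W : Type*} [AddCommGroup W] [Module ℂ W] [TopologicalSpace W]
  [IsTopologicalAddGroup W] [ContinuousSMul ℂ W] {x : Y}

lemma part10_apply (l : TangentSpace 𝓘(ℝ, V) x →L[ℝ] W) (X : TangentSpace 𝓘(ℝ, V) x) :
    part10 l X = (1 / 2 : ℂ) • (l X - Complex.I • l (tangentJ x X)) := rfl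

lemma part01_apply (l : TangentSpace 𝓘(ℝ, V) x →L[ℝ] W) (X : TangentSpace 𝓘(ℝ, V) x) :
    part01 l X = (1 / 2 : ℂ) • (l X + Complex.I • l (tangentJ x X)) := rfl

lemma tangentJ_tangentJ (X : TangentSpace 𝓘(ℝ, V) x) : tangentJ x (tangentJ x X) = -X := by
  have h : ∀ v : V, Complex.I • Complex.I • v = -v := fun v => by
    rw [smul_smul, Complex.I_mul_I, neg_one_smul]
  exact h X

lemma part10_add (l l' : TangentSpace 𝓘(ℝ, V) x →L[ℝ] W) :
    part10 (l + l') = part10 l + part10 l' := by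
  ext X; simp only [part10_apply, _root_.add_apply]; module

lemma part01_add (l l' : TangentSpace 𝓘(ℝ, V) x →L[ℝ] W) :
    part01 (l + l') = part01 l + part01 l' := by
  ext X; simp only [part01_apply, _root_.add_apply]; module

end

lemma del_mul {f g : Y → ℂ} {x : Y} (hf : MDifferentiableAt 𝓘(ℝ, V) 𝓘(ℝ, ℂ) f x)
    (hg : MDifferentiableAt 𝓘(ℝ, V) 𝓘(ℝ, ℂ) g x) (X : TangentSpace 𝓘(ℝ, V) x) :
    del (fun y => f y * g y) x X = f x * del g x X + g x * del f x X := by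
  have h : ∀ X, mvfderiv 𝓘(ℝ, V) (fun y => f y * g y) x X =
      f x * mvfderiv 𝓘(ℝ, V) g x X + g x * mvfderiv 𝓘(ℝ, V) f x X := by
    intro X
    have h2 := (hf.hasMFDerivAt.mul' hg.hasMFDerivAt).mfderiv
    have h3 := congrArg (fun l => l X) h2
    simp only [mvfderiv]
    refine h3.trans ?_
    change f x * _ + _ * g x = _
    rw [mul_comm _ (g x)]
    rfl
  simp only [del, part10_apply, h, smul_eq_mul]
  ring

lemma del_conj {f : Y → ℂ} {x : Y} (hf : MDifferentiableAt 𝓘(ℝ, V) 𝓘(ℝ, ℂ) f x)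
    (X : TangentSpace 𝓘(ℝ, V) x) :
    del (fun y => conj (f y)) x X = conj (delbar f x X) := by
  have h : ∀ X, mvfderiv 𝓘(ℝ, V) (fun y => conj (f y)) x X = conj (mvfderiv 𝓘(ℝ, V) f x X) := by
    intro X
    have h1 : HasMFDerivAt 𝓘(ℝ, ℂ) 𝓘(ℝ, ℂ) (conj : ℂ → ℂ) (f x)
      (Complex.conjCLE : ℂ →L[ℝ] ℂ) := (Complex.conjCLE.hasFDerivAt).hasMFDerivAt
    exact congrArg (fun l => l X) (h1.comp x hf.hasMFDerivAt).mfderiv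
  simp only [del, delbar, part10_apply, part01_apply, h]
  simp [Complex.conj_ofNat, sub_eq_add_neg]

lemma del_add {f g : Y → ℂ} {x : Y}
    (hf : MDifferentiableAt 𝓘(ℝ, V) 𝓘(ℝ, ℂ) f x)
    (hg : MDifferentiableAt 𝓘(ℝ, V) 𝓘(ℝ, ℂ) g x) :
    del (V := V) (fun y => f y + g y) x = del f x + del g x := by
  have h := mvfderiv_fun_add hf hg
  simp only [del]
  rw [h, part10_add]

variable (V) in
/-- Set-theoretic `1`-forms on `Y` with values in `E`. -/
abbrev Form1 (E : Y → Type*) [∀ x, AddCommGroup (E x)] [∀ x, Module ℂ (E x)]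
    [∀ x, TopologicalSpace (E x)] : Type _ :=
  ∀ x : Y, TangentSpace 𝓘(ℝ, V) x →L[ℝ] E x

variable (V) in
/-- Set-theoretic `2`-forms on `Y` with values in `E`, recorded by their values on pairs of real
tangent vectors. -/
abbrev Form2 (E : Y → Type*) : Type _ :=
  ∀ x : Y, TangentSpace 𝓘(ℝ, V) x → TangentSpace 𝓘(ℝ, V) x → E x

/-- The `(1,1)`-part of a `2`-form. -/
def Form2.part11 {E : Y → Type*} [∀ x, AddCommGroup (E x)] [∀ x, Module ℂ (E x)]
    (B : Form2 V E) : Form2 V E :=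
  fun x v w => (1 / 2 : ℂ) • (B x v w + B x (tangentJ x v) (tangentJ x w))

end Forms

section Bundle

variable {V : Type*} [NormedAddCommGroup V] [NormedSpace ℂ V] [FiniteDimensional ℂ V]
  {Y : Type*} [TopologicalSpace Y] [ChartedSpace V Y] [IsManifold 𝓘(ℂ, V) ω Y]
  {F : Type*} [NormedAddCommGroup F] [NormedSpace ℂ F]
  {E : Y → Type*} [∀ x, AddCommGroup (E x)] [∀ x, Module ℂ (E x)] [∀ x, TopologicalSpace (E x)]
  [∀ x, IsTopologicalAddGroup (E x)] [∀ x, ContinuousSMul ℂ (E x)]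
  [TopologicalSpace (TotalSpace F E)] [FiberBundle F E] [VectorBundle ℂ F E]

variable (V F) in
/-- `C^∞`-sections of `E`, i.e. elements of `A⁰(E)`. -/
def IsSmoothSection (s : ∀ x, E x) : Prop :=
  ContMDiff 𝓘(ℝ, V) (𝓘(ℝ, V).prod 𝓘(ℝ, F)) ∞ fun x => TotalSpace.mk' F x (s x)

variable (F) in
/-- `C^∞`-sections of the bundle of `E`-valued real `1`-forms, i.e. elements of `A¹(E)`. -/
def IsSmoothForm1 (α : Form1 V E) : Prop :=
  ContMDiff 𝓘(ℝ, V) (𝓘(ℝ, V).prod 𝓘(ℝ, V →L[ℝ] F)) ∞ fun x =>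
    TotalSpace.mk' (V →L[ℝ] F) (E := fun x : Y => TangentSpace 𝓘(ℝ, V) x →L[ℝ] E x) x (α x)

variable (V F E) in
/-- A `λ`-connection `A⁰(E) → A¹(E)`. It is recorded as a function on all set-theoretic sections,
but only its values on `C^∞`-sections are constrained, or matter. -/
structure LambdaConnection (lam : ℂ) where
  toFun : (∀ x, E x) → Form1 V E
  smooth : ∀ s, IsSmoothSection V F s → IsSmoothForm1 F (toFun s)
  add : ∀ s t, IsSmoothSection V F s → IsSmoothSection V F t →
    toFun (s + t) = toFun s + toFun t
  leibniz : ∀ (f : Y → ℂ) (s : ∀ x, E x), ContMDiff 𝓘(ℝ, V) 𝓘(ℝ, ℂ) ∞ f →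
    IsSmoothSection V F s → ∀ x,
      toFun (fun y => f y • s y) x =
        f x • toFun s x + (lam • del f x + delbar f x).smulRight (s x)

variable (V F E) in
/-- A `C^∞` Hermitian metric on `E`; it is complex linear in the first variable. -/
structure HermitianMetric where
  inner : ∀ x, E x →ₗ[ℂ] E x →ₗ⋆[ℂ] ℂ
  conj_symm : ∀ x (u v : E x), inner x v u = conj (inner x u v)
  pos : ∀ x (u : E x), u ≠ 0 → 0 < (inner x u u).re
  smooth : ∀ s t : ∀ x, E x, IsSmoothSection V F s → IsSmoothSection V F t →
    ContMDiff 𝓘(ℝ, V) 𝓘(ℝ, ℂ) ∞ fun x => inner x (s x) (t x)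

section Riesz

variable [T2Space Y] [FiniteDimensional ℂ F] [ContMDiffVectorBundle ∞ F E 𝓘(ℝ, V)]

lemma IsSmoothSection.smul {f : Y → ℂ} (hf : ContMDiff 𝓘(ℝ, V) 𝓘(ℝ, ℂ) ∞ f) {s : ∀ x, E x}
    (hs : IsSmoothSection V F s) : IsSmoothSection V F (fun y => f y • s y) := by
  intro x₀
  have hs := hs x₀
  rw [contMDiffAt_section] at hs ⊢
  set e := trivializationAt F E x₀
  refine (((ContinuousLinearMap.lsmul ℝ ℂ : ℂ →L[ℝ] F →L[ℝ] F).isBoundedBilinearMap.contDiff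
    (n := ∞)).comp_contMDiffAt ((hf x₀).prodMk_space hs)).congr_of_eventuallyEq ?_
  filter_upwards [e.open_baseSet.mem_nhds (FiberBundle.mem_baseSet_trivializationAt' x₀)] with y hy
  exact (e.linear ℂ hy).2 _ _

lemma exists_functional (x : Y) (Φ : (∀ x, E x) → ℝ)
    (hadd : ∀ s t, IsSmoothSection V F s → IsSmoothSection V F t → Φ (s + t) = Φ s + Φ t)
    (hsmul : ∀ (f : Y → ℝ) s, ContMDiff 𝓘(ℝ, V) 𝓘(ℝ, ℝ) ∞ f → IsSmoothSection V F s →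
      Φ (f • s) = f x * Φ s) :
    ∃ φ : E x →ₗ[ℝ] ℝ, ∀ u, IsSmoothSection V F u → Φ u = φ (u x) := by
  classical
  set e := trivializationAt F E x with he
  have hx : x ∈ e.baseSet := FiberBundle.mem_baseSet_trivializationAt' x
  let b := Module.finBasis ℝ F
  obtain ⟨χ, -, hχ⟩ := (SmoothBumpFunction.nhds_basis_tsupport (I := 𝓘(ℝ, V)) x).mem_iff.1
    (e.open_baseSet.mem_nhds hx)
  have : ContMDiffVectorBundle 1 F E 𝓘(ℝ, V) := .of_le (n := ∞) (by norm_cast)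
  let S : Fin (Module.finrank ℝ F) → ∀ y, E y := fun i => (χ : Y → ℝ) • e.localFrame b i
  have hS : ∀ i, IsSmoothSection V F (S i) := fun i =>
    ContMDiffOn.smul_section_of_tsupport (χ.contMDiff.contMDiffOn) e.open_baseSet hχ
      (e.contMDiffOn_localFrame_baseSet (I := 𝓘(ℝ, V)) ∞ b i)
  have hSx : ∀ i, S i x = e.basisAt b hx i := fun i => by
    simp [S, hx]
  have hsum : ∀ (t : Finset (Fin (Module.finrank ℝ F))) (σ : Fin (Module.finrank ℝ F) → ∀ y, E y),
      (∀ i, IsSmoothSection V F (σ i)) →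
      IsSmoothSection V F (∑ i ∈ t, σ i) ∧ Φ (∑ i ∈ t, σ i) = ∑ i ∈ t, Φ (σ i) := by
    intro t σ hσ
    induction t using Finset.induction_on with
    | empty =>
      have h0 : IsSmoothSection V F (0 : ∀ y, E y) := contMDiff_zeroSection ℝ E
      refine ⟨by simpa using h0, ?_⟩
      have := hadd 0 0 h0 h0
      simpa using this
    | insert i t hi ih =>
      rw [Finset.sum_insert hi, Finset.sum_insert hi]
      exact ⟨(hσ i).add_section ih.1, by rw [hadd _ _ (hσ i) ih.1, ih.2]⟩
  refine ⟨(e.basisAt b hx).constr ℝ fun i => Φ (S i), fun u hu => ?_⟩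
  let c : Fin (Module.finrank ℝ F) → Y → ℝ := fun i y => χ y • e.localFrameCoeff 𝓘(ℝ, V) b i y (u y)
  have hc : ∀ i, ContMDiff 𝓘(ℝ, V) 𝓘(ℝ, ℝ) ∞ (c i) := by
    intro i
    refine contMDiff_of_tsupport fun y hy => ?_
    have hy' : y ∈ e.baseSet := hχ (tsupport_smul_subset_left _ _ hy)
    exact χ.contMDiff.contMDiffAt.smul (contMDiffAt_localFrameCoeff b hy' (hu y) i)
  have h1 : (fun y => χ y * χ y) • u = ∑ i, (c i) • S i := by
    funext y
    simp only [Finset.sum_apply, Pi.smul_apply', S, c]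
    by_cases hy : y ∈ e.baseSet
    · conv_lhs => rw [e.eq_sum_localFrameCoeff_smul (I := 𝓘(ℝ, V)) (b := b) (s := u) hy]
      rw [Finset.smul_sum]
      refine Finset.sum_congr rfl fun i _ => ?_
      simp only [smul_smul, smul_eq_mul]
      congr 1; ring
    · have : χ y = 0 := image_eq_zero_of_notMem_tsupport fun h => hy (hχ h)
      simp [this]
  have h2 := hsmul (fun y => χ y * χ y) u (χ.contMDiff.mul χ.contMDiff) hu
  rw [h1, (hsum _ _ fun i => (hc i).smul_section (hS i)).2] at h2
  simp only [χ.eq_one, one_mul] at h2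
  rw [← h2, Module.Basis.constr_apply_fintype]
  refine Finset.sum_congr rfl fun i _ => ?_
  rw [hsmul _ _ (hc i) (hS i), smul_eq_mul]
  congr 1
  simp [c, e.localFrameCoeff_apply_of_mem_baseSet b hx, Module.Basis.equivFun_apply]


lemma exists_section (x : Y) (w : E x) : ∃ u, IsSmoothSection V F u ∧ u x = w := by
  set e := trivializationAt F E x with he
  have hx : x ∈ e.baseSet := FiberBundle.mem_baseSet_trivializationAt' x
  obtain ⟨χ, -, hχ⟩ := (SmoothBumpFunction.nhds_basis_tsupport (I := 𝓘(ℝ, V)) x).mem_iff.1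
    (e.open_baseSet.mem_nhds hx)
  refine ⟨(χ : Y → ℝ) • fun y => e.symm y (e ⟨x, w⟩).2,
    ContMDiffOn.smul_section_of_tsupport (χ.contMDiff.contMDiffOn) e.open_baseSet hχ ?_, ?_⟩
  · rw [e.contMDiffOn_section_baseSet_iff]
    apply (contMDiffOn_const (c := (e ⟨x, w⟩).2)).congr
    intro y hy
    simp [e.apply_mk_symm hy]
  · simp [e.symm_apply_apply_mk hx]

lemma HermitianMetric.riesz (h : HermitianMetric V F E) (x : Y) (φ : E x →ₗ[ℝ] ℝ) :
    ∃ v, ∀ w, φ w = (h.inner x v w).re := by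
  set e := trivializationAt F E x with he
  have hx : x ∈ e.baseSet := FiberBundle.mem_baseSet_trivializationAt' x
  have : FiniteDimensional ℝ (E x) := (e.linearEquivAt ℝ x hx).symm.finiteDimensional
  let A : E x →ₗ[ℝ] Module.Dual ℝ (E x) := LinearMap.mk₂ ℝ (fun v w => (h.inner x v w).re)
    (fun v v' w => by simp) (fun c v w => by simp [← Complex.coe_smul])
    (fun v w w' => by simp) (fun c v w => by simp [← Complex.coe_smul])
  have hA : Function.Injective A := by
    rw [injective_iff_map_eq_zero]
    intro v hv
    by_contra hne
    have h1 := h.pos x v hne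
    have h2 : A v v = 0 := by rw [hv]; rfl
    exact h1.ne' h2
  obtain ⟨v, hv⟩ := (LinearMap.injective_iff_surjective_of_finrank_eq_finrank
    (Subspace.dual_finrank_eq (K := ℝ) (V := E x)).symm).1 hA φ
  exact ⟨v, fun w => by rw [← hv]; rfl⟩

lemma HermitianMetric.ext_left (h : HermitianMetric V F E) (x : Y) {v v' : E x}
    (hv : ∀ w, h.inner x v w = h.inner x v' w) : v = v' := by
  by_contra hne
  have h1 := h.pos x (v - v') (sub_ne_zero.2 hne)
  have h2 : h.inner x (v - v') (v - v') = 0 := by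
    rw [map_sub (h.inner x), LinearMap.sub_apply, hv, sub_self]
  rw [h2] at h1
  simp at h1

lemma HermitianMetric.exists_rep (h : HermitianMetric V F E) (x : Y)
    (Φ : (∀ x, E x) → TangentSpace 𝓘(ℝ, V) x → ℂ)
    (hX : ∀ u, IsSmoothSection V F u → IsLinearMap ℝ (Φ u))
    (hadd : ∀ s t, IsSmoothSection V F s → IsSmoothSection V F t → ∀ X,
      Φ (s + t) X = Φ s X + Φ t X)
    (hsmul : ∀ (f : Y → ℂ) s, ContMDiff 𝓘(ℝ, V) 𝓘(ℝ, ℂ) ∞ f → IsSmoothSection V F s → ∀ X,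
      Φ (fun y => f y • s y) X = conj (f x) * Φ s X) :
    ∃ l : TangentSpace 𝓘(ℝ, V) x →L[ℝ] E x,
      ∀ u, IsSmoothSection V F u → ∀ X, Φ u X = h.inner x (l X) (u x) := by
  have key : ∀ X, ∃ v : E x, ∀ u, IsSmoothSection V F u → Φ u X = h.inner x v (u x) := by
    intro X
    obtain ⟨φ, hφ⟩ := exists_functional (V := V) (F := F) (E := E) x (fun u => (Φ u X).re)
      (fun s t hs ht => by simp [hadd s t hs ht]) (fun f s hf hs => by
        have := hsmul (fun y => (f y : ℂ)) s (Complex.ofRealCLM.contDiff.comp_contMDiff hf) hs X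
        have h2 : (fun y => (f y : ℂ) • s y) = f • s := by
          funext y; simp
        rw [h2] at this
        simp [this])
    obtain ⟨v, hv⟩ := h.riesz x φ
    have hre : ∀ u, IsSmoothSection V F u → (Φ u X).re = (h.inner x v (u x)).re :=
      fun u hu => by rw [hφ u hu, hv]
    refine ⟨v, fun u hu => Complex.ext (hre u hu) ?_⟩
    have h1 := hre _ (hu.smul (f := fun _ => Complex.I) contMDiff_const)
    rw [hsmul _ _ contMDiff_const hu] at h1
    simpa using h1
  choose l hl using key
  have hlin : IsLinearMap ℝ l := by
    constructor
    · intro X X'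
      refine h.ext_left x fun w => ?_
      obtain ⟨u, hu, rfl⟩ := exists_section (V := V) (F := F) x w
      rw [map_add, LinearMap.add_apply, ← hl _ u hu, ← hl _ u hu, ← hl _ u hu, (hX u hu).map_add]
    · intro r X
      refine h.ext_left x fun w => ?_
      obtain ⟨u, hu, rfl⟩ := exists_section (V := V) (F := F) x w
      rw [← Complex.coe_smul, map_smul, LinearMap.smul_apply, ← hl _ u hu, ← hl _ u hu,
        (hX u hu).map_smul]
      simp
  have : FiniteDimensional ℝ (TangentSpace 𝓘(ℝ, V) x) := inferInstanceAs (FiniteDimensional ℝ V)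
  have : T2Space (TangentSpace 𝓘(ℝ, V) x) := inferInstanceAs (T2Space V)
  exact ⟨LinearMap.toContinuousLinearMap (hlin.mk' l), fun u hu X => hl X u hu⟩

end Riesz

/-! ### The extension of an operator `A⁰(E) → A¹(E)` to `A¹(E) → A²(E)` -/

/-- A fixed cut-off function around `x`, equal to `1` near `x`. -/
def cutoff (x : Y) : SmoothBumpFunction 𝓘(ℝ, V) x := Classical.arbitrary _

/-- A vector field extending `v`, which near `x` has constant coefficients in a holomorphic chart
around `x`. -/
def coordField (x : Y) (v : TangentSpace 𝓘(ℝ, V) x) (y : Y) : TangentSpace 𝓘(ℝ, V) y :=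
  (cutoff (V := V) x y) •
    (trivializationAt V (TangentSpace 𝓘(ℝ, V) : Y → Type _) x).symmL ℝ y v

lemma coordField_self (x : Y) (v : TangentSpace 𝓘(ℝ, V) x) : coordField x v x = v := by
  have h2 := TangentBundle.symmL_trivializationAt_eq_core (I := 𝓘(ℝ, V)) (b₀ := x) (b := x)
    (mem_chart_source V x)
  have h3 := congrArg (fun l => l v) h2
  simp only [coordField, SmoothBumpFunction.eq_one, one_smul]
  refine h3.trans ?_
  exact (tangentBundleCore 𝓘(ℝ, V) Y).coordChange_self (achart V x) x (mem_chart_source V x) v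

/-- The extension to `1`-forms of an operator `T : A⁰(E) → A¹(E)` such that
`T (f s) = f T s + (a ∂f + b ∂̄f) ⊗ s` for some complex numbers `a`, `b`. It is characterised by
`T (η ⊗ s) = (a ∂η + b ∂̄η) ⊗ s - η ∧ T s`. As `∂` and `∂̄` kill the `1`-forms which have constant
coefficients in holomorphic coordinates, its value on two coordinate vector fields `v`, `w` is
`T (α w) v - T (α v) w`, without a Lie bracket term and whatever `a` and `b` are. -/
def extend (T : (∀ x, E x) → Form1 V E) (α : Form1 V E) : Form2 V E := fun x v w =>
  T (fun y => α y (coordField x w y)) x v - T (fun y => α y (coordField x v y)) x w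

/-- The composition `A⁰(E) → A¹(E) → A²(E)` of two operators. -/
def comp (S T : (∀ x, E x) → Form1 V E) (s : ∀ x, E x) : Form2 V E := extend S (T s)

/-- The graded commutator `[S, T] = S ∘ T + T ∘ S` of two operators of degree one. -/
def gradedComm (S T : (∀ x, E x) → Form1 V E) (s : ∀ x, E x) : Form2 V E :=
  comp S T s + comp T S s

namespace LambdaConnection

variable {lam : ℂ} (D : LambdaConnection V F E lam) (h : HermitianMetric V F E)

/-- Flatness: `D ∘ D = 0`. -/
def IsFlat : Prop :=
  ∀ s : ∀ x, E x, IsSmoothSection V F s → comp D.toFun D.toFun s = 0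

/-- `d''_E`, the `(0,1)`-part of `D`. -/
def dbar (s : ∀ x, E x) : Form1 V E := fun x => part01 (D.toFun s x)

/-- `d'_E`, the `(1,0)`-part of `D`. -/
def dprime (s : ∀ x, E x) : Form1 V E := fun x => part10 (D.toFun s x)

/-- The identity `∂ h(s,u) = h(δ's, u) + h(s, d''u)` at `x`, for `l` as the value of `δ's`. -/
def IsDeltaPrimeAt (s : ∀ x, E x) (x : Y) (l : TangentSpace 𝓘(ℝ, V) x →L[ℝ] E x) : Prop :=
  ∀ u : ∀ x, E x, IsSmoothSection V F u → ∀ X : TangentSpace 𝓘(ℝ, V) x,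
    del (fun y => h.inner y (s y) (u y)) x X =
      h.inner x (l X) (u x) + h.inner x (s x) (D.dbar u x X)

/-- The identity `λ ∂ h(u,s) = h(d'u, s) + h(u, δ''s)` at `x`, for `l` as the value of `δ''s`. -/
def IsDeltaDoublePrimeAt (s : ∀ x, E x) (x : Y) (l : TangentSpace 𝓘(ℝ, V) x →L[ℝ] E x) : Prop :=
  ∀ u : ∀ x, E x, IsSmoothSection V F u → ∀ X : TangentSpace 𝓘(ℝ, V) x,
    lam * del (fun y => h.inner y (u y) (s y)) x X =
      h.inner x (D.dprime u x X) (s x) + h.inner x (u x) (l X)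

/-- `δ'_{E,h}`: the operator such that `d''_E + δ'_{E,h}` is the Chern connection. -/
def deltaPrime (s : ∀ x, E x) : Form1 V E := fun x =>
  Classical.epsilon (D.IsDeltaPrimeAt h s x)

/-- `δ''_{E,h}`: the operator determined by `λ ∂ h(u,v) = h(d'_E u, v) + h(u, δ''_{E,h} v)`. -/
def deltaDoublePrime (s : ∀ x, E x) : Form1 V E := fun x =>
  Classical.epsilon (D.IsDeltaDoublePrimeAt h s x)

/-- `∂̄_{E,h} = (d'' + λ δ'') / (1 + |λ|²)`. -/
def dbarE (s : ∀ x, E x) : Form1 V E := fun x =>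
  (1 / (1 + (‖lam‖ : ℂ) ^ 2)) • (D.dbar s x + lam • D.deltaDoublePrime h s x)

/-- `θ_{E,h} = (d' - λ δ') / (1 + |λ|²)`. -/
def theta (s : ∀ x, E x) : Form1 V E := fun x =>
  (1 / (1 + (‖lam‖ : ℂ) ^ 2)) • (D.dprime s x - lam • D.deltaPrime h s x)

/-- `𝔻^{λ⋆}_{E,h} = δ' - δ''`. -/
def dStar (s : ∀ x, E x) : Form1 V E := fun x =>
  D.deltaPrime h s x - D.deltaDoublePrime h s x

/-- `G(h) = [𝔻^λ, 𝔻^{λ⋆}_{E,h}]`. -/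
def G (s : ∀ x, E x) : Form2 V E := gradedComm D.toFun (D.dStar h) s

/-- `G(h) = 0`, i.e. `h` is pluri-harmonic. -/
def IsPluriharmonic : Prop :=
  ∀ s : ∀ x, E x, IsSmoothSection V F s → D.G h s = 0

/-- `G(h)^{1,1} = 0`. -/
def G11Vanishes : Prop :=
  ∀ s : ∀ x, E x, IsSmoothSection V F s → (D.G h s).part11 = 0

/-- `∂̄_{E,h} θ_{E,h} = 0`, where `∂̄_{E,h} θ_{E,h} = [∂̄_{E,h}, θ_{E,h}]` is the derivative of the
`End(E)`-valued form `θ_{E,h}`. -/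
def DbarThetaVanishes : Prop :=
  ∀ s : ∀ x, E x, IsSmoothSection V F s → gradedComm (D.dbarE h) (D.theta h) s = 0


section Existence

variable [T2Space Y] [FiniteDimensional ℂ F] [ContMDiffVectorBundle ∞ F E 𝓘(ℝ, V)]

lemma dbar_smul {f : Y → ℂ} (hf : ContMDiff 𝓘(ℝ, V) 𝓘(ℝ, ℂ) ∞ f) {s : ∀ x, E x}
    (hs : IsSmoothSection V F s) (x : Y) (X : TangentSpace 𝓘(ℝ, V) x) :
    D.dbar (fun y => f y • s y) x X = f x • D.dbar s x X + delbar f x X • s x := by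
  simp only [dbar, D.leibniz f s hf hs, part01_apply, _root_.add_apply,
    _root_.smul_apply, ContinuousLinearMap.smulRight_apply, del, delbar,
    part10_apply, tangentJ_tangentJ, map_neg]
  simp only [smul_eq_mul]
  match_scalars <;> first
    | ring1
    | linear_combination (lam * mvfderiv 𝓘(ℝ, V) f x X / 4 - mvfderiv 𝓘(ℝ, V) f x X / 4) * Complex.I_sq

lemma dprime_smul {f : Y → ℂ} (hf : ContMDiff 𝓘(ℝ, V) 𝓘(ℝ, ℂ) ∞ f) {s : ∀ x, E x}
    (hs : IsSmoothSection V F s) (x : Y) (X : TangentSpace 𝓘(ℝ, V) x) :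
    D.dprime (fun y => f y • s y) x X = f x • D.dprime s x X + (lam * del f x X) • s x := by
  simp only [dprime, D.leibniz f s hf hs, part01_apply, _root_.add_apply,
    _root_.smul_apply, ContinuousLinearMap.smulRight_apply, del, delbar,
    part10_apply, tangentJ_tangentJ, map_neg]
  simp only [smul_eq_mul]
  match_scalars <;> first
    | ring1
    | linear_combination -(lam * mvfderiv 𝓘(ℝ, V) f x X / 4 - mvfderiv 𝓘(ℝ, V) f x X / 4) * Complex.I_sq

/-- The defining identity of `δ'` holds. -/
theorem deltaPrime_spec {s : ∀ x, E x} (hs : IsSmoothSection V F s) (x : Y) :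
    D.IsDeltaPrimeAt h s x (D.deltaPrime h s x) := by
  refine Classical.epsilon_spec (p := D.IsDeltaPrimeAt h s x) ?_
  have hd : ∀ u, IsSmoothSection V F u →
      MDifferentiableAt 𝓘(ℝ, V) 𝓘(ℝ, ℂ) (fun y => h.inner y (s y) (u y)) x := fun u hu =>
    (h.smooth s u hs hu x).mdifferentiableAt (by simp)
  obtain ⟨l, hl⟩ := h.exists_rep x
    (fun u X => del (fun y => h.inner y (s y) (u y)) x X - h.inner x (s x) (D.dbar u x X))
    (fun u _ => ⟨fun X X' => by simp only [map_add]; ring, fun r X => by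
      simp only [map_smul]
      rw [← Complex.coe_smul r (D.dbar u x X), LinearMap.map_smulₛₗ]
      simp [mul_sub]⟩)
    (fun u u' hu hu' X => by
      have h1 : D.dbar (u + u') x = D.dbar u x + D.dbar u' x := by
        simp only [dbar, D.add u u' hu hu', Pi.add_apply, part01_add]
      simp only [Pi.add_apply, map_add, h1, _root_.add_apply,
        del_add (hd u hu) (hd u' hu')]
      ring)
    (fun f u hf hu X => by
      have hfd := (hf x).mdifferentiableAt (by simp : (∞ : ℕ∞ω) ≠ 0)
      have hcf : MDifferentiableAt 𝓘(ℝ, V) 𝓘(ℝ, ℂ) (fun y => conj (f y)) x :=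
        (Complex.conjCLE.contDiff.comp_contMDiff hf x).mdifferentiableAt
          (by simp : (∞ : ℕ∞ω) ≠ 0)
      simp only [LinearMap.map_smulₛₗ, smul_eq_mul, D.dbar_smul hf hu, map_add,
        del_mul hcf (hd u hu), del_conj hfd]
      ring)
  exact ⟨l, fun u hu X => by rw [← hl u hu]; ring⟩

/-- The defining identity of `δ''` holds. -/
theorem deltaDoublePrime_spec {s : ∀ x, E x} (hs : IsSmoothSection V F s) (x : Y) :
    D.IsDeltaDoublePrimeAt h s x (D.deltaDoublePrime h s x) := by
  refine Classical.epsilon_spec (p := D.IsDeltaDoublePrimeAt h s x) ?_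
  have hd : ∀ u, IsSmoothSection V F u →
      MDifferentiableAt 𝓘(ℝ, V) 𝓘(ℝ, ℂ) (fun y => h.inner y (u y) (s y)) x := fun u hu =>
    (h.smooth u s hu hs x).mdifferentiableAt (by simp)
  obtain ⟨l, hl⟩ := h.exists_rep x
    (fun u X => conj (lam * del (fun y => h.inner y (u y) (s y)) x X -
      h.inner x (D.dprime u x X) (s x)))
    (fun u _ => ⟨fun X X' => by simp only [map_add, map_sub, map_mul, LinearMap.add_apply]; ring,
      fun r X => by
      simp only [map_smul]
      rw [← Complex.coe_smul r (D.dprime u x X), map_smul (h.inner x)]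
      simp
      ring⟩)
    (fun u u' hu hu' X => by
      have h1 : D.dprime (u + u') x = D.dprime u x + D.dprime u' x := by
        simp only [dprime, D.add u u' hu hu', Pi.add_apply, part10_add]
      simp only [Pi.add_apply, map_add, h1, _root_.add_apply, LinearMap.add_apply,
        del_add (hd u hu) (hd u' hu'), map_sub, map_mul]
      ring)
    (fun f u hf hu X => by
      have hfd := (hf x).mdifferentiableAt (by simp : (∞ : ℕ∞ω) ≠ 0)
      simp only [map_smul, LinearMap.smul_apply, smul_eq_mul, D.dprime_smul hf hu, map_add,
        LinearMap.add_apply, del_mul hfd (hd u hu), ← map_mul]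
      congr 1
      ring)
  refine ⟨l, fun u hu X => ?_⟩
  rw [h.conj_symm x (l X) (u x), ← hl u hu, Complex.conj_conj]
  ring

/-- `δ'` is the only operator with its defining identity. -/
theorem IsDeltaPrimeAt.unique {s : ∀ x, E x} {x : Y}
    {l l' : TangentSpace 𝓘(ℝ, V) x →L[ℝ] E x} (hl : D.IsDeltaPrimeAt h s x l)
    (hl' : D.IsDeltaPrimeAt h s x l') : l = l' := by
  ext X
  refine h.ext_left x fun w => ?_
  obtain ⟨u, hu, rfl⟩ := exists_section (V := V) (F := F) x w
  exact add_right_cancel ((hl u hu X).symm.trans (hl' u hu X))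

/-- `δ''` is the only operator with its defining identity. -/
theorem IsDeltaDoublePrimeAt.unique {s : ∀ x, E x} {x : Y}
    {l l' : TangentSpace 𝓘(ℝ, V) x →L[ℝ] E x} (hl : D.IsDeltaDoublePrimeAt h s x l)
    (hl' : D.IsDeltaDoublePrimeAt h s x l') : l = l' := by
  ext X
  refine h.ext_left x fun w => ?_
  obtain ⟨u, hu, rfl⟩ := exists_section (V := V) (F := F) x w
  rw [h.conj_symm x (u x) (l X), h.conj_symm x (u x) (l' X)]
  exact congrArg conj (add_left_cancel ((hl u hu X).symm.trans (hl' u hu X)))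

end Existence

end LambdaConnection

end Bundle

end LambdaFlat

end

noncomputable section

set_option linter.unusedSectionVars false

namespace LambdaFlat

open Filter Topology

variable {V : Type*} [NormedAddCommGroup V] [NormedSpace ℂ V] [FiniteDimensional ℂ V]
  {Y : Type*} [TopologicalSpace Y] [ChartedSpace V Y] [IsManifold 𝓘(ℂ, V) ω Y]

/-! ### Coordinate vector fields -/

/-! Let B = d'' + λδ'' and Θ = d' - λδ', the multiples of ∂̄_{E,h} and θ_{E,h} by 1 + |λ|². Flatness
kills every bracket among d' and d''. As δ' and δ'' are adjoint to d'' and d', the brackets among δ'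
and δ'' vanish too (`IsFlat.bracket_delta_eq_zero`). So only mixed terms survive in the brackets of
type (B, Θ), (Θ, Θ) and (B, B), and these are -λ times the (1,1)-, (2,0)- and (0,2)-parts of G(h).
For λ ≠ 0 this already identifies G(h)^{1,1} = 0 with ∂̄_{E,h} θ_{E,h} = 0.

In Θ the derivatives of the metric cancel, so Θ is an End(E)-valued form, with adjoint Θ† = conj(λ)
d'' - δ''. The bracket of Θ† with itself is conj(λ) G(h)^{0,2}, hence proportional to the curvature
of B.

Now let G(h)^{1,1} = 0. Then B commutes with Θ, so the curvature of B, and with it [Θ†, Θ†],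
commutes with Θ. For tangent vectors v, w at one point put a = Θ_v, c = Θ_w, n = [a, c] and m = [a*,
c*] = -n*. As m commutes with c, mn = [ma, c] has trace zero, so tr(n*n) = 0 and n = m = 0
(`commute_of_commute_adjoint_commutator`). This gives G(h)^{2,0} = 0 and G(h)^{0,2} = 0.

Forms are tested on the fields `coordField x v`, which are constant in a holomorphic chart near x,
so no Lie brackets appear. Commuting B past Θ twice uses [B, Θ] = 0 at points y near x in the chart
of x, whereas the hypothesis at y is read in the chart of y;
`IsFirstOrder.bracket_eq_zero_of_isFlatNear` bridges the two. -/

omit [FiniteDimensional ℂ V] in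
lemma tangentCoordChange_I_smul {x y z : Y} (hx : z ∈ (chartAt V x).source)
    (hy : z ∈ (chartAt V y).source) (v : V) :
    tangentCoordChange 𝓘(ℝ, V) x y z (Complex.I • v) =
      Complex.I • tangentCoordChange 𝓘(ℝ, V) x y z v := by
  have h1 := hasFDerivWithinAt_tangentCoordChange (I := 𝓘(ℝ, V)) (x := x) (y := y) (z := z)
    (by simp [hx, hy])
  have h2 := hasFDerivWithinAt_tangentCoordChange (I := 𝓘(ℂ, V)) (x := x) (y := y) (z := z)
    (by simp [hx, hy])
  rw [modelWithCornersSelf_coe, Set.range_id, hasFDerivWithinAt_univ] at h1 h2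
  -- The real and the complex coordinate change are derivatives of the same transition map, so the
  -- real one is complex linear.
  have h3 := h1.unique (h2.restrictScalars ℝ)
  rw [h3]
  exact map_smul (tangentCoordChange 𝓘(ℂ, V) x y z) Complex.I v

lemma cutoff_eq_zero {x y : Y} (hy : y ∉ (chartAt V x).source) : cutoff (V := V) x y = 0 := by
  by_contra h
  exact hy ((cutoff (V := V) x).support_subset_source h)

/-- Because transition maps are holomorphic, constant coefficients in the chart at `x` are
compatible with J. This lets types of forms be read off from operators along coordinate fields. -/
lemma coordField_tangentJ (x : Y) (v : TangentSpace 𝓘(ℝ, V) x) (y : Y) :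
    coordField x (tangentJ x v) y = tangentJ y (coordField x v y) := by
  by_cases hy : y ∈ (chartAt V x).source
  · simp only [coordField, map_smul]
    congr 1
    rw [TangentBundle.symmL_trivializationAt_eq_core hy]
    exact tangentCoordChange_I_smul hy (mem_chart_source V y) v
  · simp [coordField, cutoff_eq_zero hy]

/-- Near `y`, the fields `coordField x v` have constant coefficients in the chart at `x`. -/
def IsFlatNear (x y : Y) : Prop :=
  ∀ᶠ z in 𝓝 y, cutoff (V := V) x z = 1 ∧ z ∈ (chartAt V x).source

lemma isFlatNear_self (x : Y) : IsFlatNear (V := V) x x :=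
  (cutoff (V := V) x).eventuallyEq_one.and ((chartAt V x).open_source.mem_nhds (mem_chart_source V x))

lemma eventually_isFlatNear (x : Y) : ∀ᶠ y in 𝓝 x, IsFlatNear (V := V) x y :=
  eventually_eventually_nhds.2 (isFlatNear_self x)

variable [T2Space Y]

lemma contMDiff_coordField (x : Y) (v : TangentSpace 𝓘(ℝ, V) x) :
    ContMDiff 𝓘(ℝ, V) (𝓘(ℝ, V).prod 𝓘(ℝ, V)) ∞
      fun y => TotalSpace.mk' V (E := fun y : Y => TangentSpace 𝓘(ℝ, V) y) y (coordField x v y) := by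
  set e := trivializationAt V (TangentSpace 𝓘(ℝ, V) : Y → Type _) x with he
  have : ContMDiffVectorBundle ∞ V (TangentSpace 𝓘(ℝ, V) : Y → Type _) 𝓘(ℝ, V) :=
    TangentBundle.contMDiffVectorBundle (h := .of_le (n := ω) (by simp))
  refine ContMDiffOn.smul_section_of_tsupport (F := V) (V := (TangentSpace 𝓘(ℝ, V) : Y → Type _))
    (s := fun y => e.symmL ℝ y v)
    ((cutoff (V := V) x).contMDiff.contMDiffOn)
    e.open_baseSet (by simpa [he] using (cutoff (V := V) x).tsupport_subset_chartAt_source) ?_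
  rw [e.contMDiffOn_section_baseSet_iff]
  apply (contMDiffOn_const (M' := V) (c := v)).congr
  intro y hy
  have h := e.continuousLinearMapAt_symmL (R := ℝ) hy v
  rw [e.continuousLinearMapAt_apply (R := ℝ), e.coe_linearMapAt_of_mem (R := ℝ) hy] at h
  exact h

lemma contMDiff_mvfderiv_apply {f : Y → ℂ} (hf : ContMDiff 𝓘(ℝ, V) 𝓘(ℝ, ℂ) ∞ f)
    {X : ∀ y : Y, TangentSpace 𝓘(ℝ, V) y}
    (hX : ContMDiff 𝓘(ℝ, V) (𝓘(ℝ, V).prod 𝓘(ℝ, V)) ∞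
      fun y => TotalSpace.mk' V (E := fun y : Y => TangentSpace 𝓘(ℝ, V) y) y (X y)) :
    ContMDiff 𝓘(ℝ, V) 𝓘(ℝ, ℂ) ∞ fun y => mvfderiv 𝓘(ℝ, V) f y (X y) := by
  have h1 := hf.contMDiff_tangentMap (m := ∞) (by simp)
  exact (contMDiff_snd_tangentBundle_modelSpace ℂ 𝓘(ℝ, ℂ)).comp (h1.comp hX)

lemma mvfderiv_coordField {f : Y → ℂ} (hf : ContMDiff 𝓘(ℝ, V) 𝓘(ℝ, ℂ) ∞ f) {x z : Y}
    (hz : cutoff (V := V) x z = 1) (hz' : z ∈ (chartAt V x).source) (v : TangentSpace 𝓘(ℝ, V) x) :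
    mvfderiv 𝓘(ℝ, V) f z (coordField x v z) =
      fderiv ℝ (f ∘ (chartAt V x).symm) (chartAt V x z) v := by
  have hinv : (chartAt V x).symm (chartAt V x z) = z := (chartAt V x).left_inv hz'
  have h1 : MDifferentiableAt 𝓘(ℝ, V) 𝓘(ℝ, V) (chartAt V x).symm (chartAt V x z) :=
    mdifferentiableAt_atlas_symm (I := 𝓘(ℝ, V)) (chart_mem_atlas V x) ((chartAt V x).map_source hz')
  have h2 : MDifferentiableAt 𝓘(ℝ, V) 𝓘(ℝ, ℂ) f z := (hf z).mdifferentiableAt (by simp)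
  have h3 := congrArg (fun l => l (v : V)) (mfderiv_comp_of_eq (y := z) h2 h1 hinv)
  have h4 := TangentBundle.symmL_trivializationAt (I := 𝓘(ℝ, V)) (𝕜 := ℝ) hz'
  simp only [mfld_simps, mfderivWithin_univ] at h4
  rw [coordField, hz, one_smul, h4, ← mfderiv_eq_fderiv]
  refine Eq.trans ?_ h3.symm
  simp only [mvfderiv]
  -- The derivative in `h3` lives at a base point equal to `z` only propositionally; it is made a
  -- variable so that it can be substituted.
  generalize (chartAt V x).symm (chartAt V x z) = z' at *
  subst hinv
  rfl

/-- Symmetry of the second derivative of `f` read in the chart at `x`. The outer derivative sees a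
neighbourhood of `y`, hence the hypothesis `IsFlatNear` instead of a condition at `y` alone. -/
lemma mvfderiv_coordField_comm {f : Y → ℂ} (hf : ContMDiff 𝓘(ℝ, V) 𝓘(ℝ, ℂ) ∞ f) {x y : Y}
    (hy : IsFlatNear (V := V) x y) (v w : TangentSpace 𝓘(ℝ, V) x) :
    mvfderiv 𝓘(ℝ, V) (fun z => mvfderiv 𝓘(ℝ, V) f z (coordField x w z)) y (coordField x v y) =
    mvfderiv 𝓘(ℝ, V) (fun z => mvfderiv 𝓘(ℝ, V) f z (coordField x v z)) y (coordField x w y) := by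
  obtain ⟨hy1, hy2⟩ := hy.self_of_nhds
  set g := f ∘ (chartAt V x).symm with hg
  have hcont : ContinuousAt (chartAt V x).symm (chartAt V x y) :=
    (chartAt V x).continuousAt_symm ((chartAt V x).map_source hy2)
  have hinv : (chartAt V x).symm (chartAt V x y) = y := (chartAt V x).left_inv hy2
  have hgs : ContDiffAt ℝ ∞ g (chartAt V x y) := by
    rw [← contMDiffAt_iff_contDiffAt]
    refine (hf _).comp (chartAt V x y) ?_
    exact contMDiffAt_symm_of_mem_maximalAtlas
      (IsManifold.chart_mem_maximalAtlas x) ((chartAt V x).map_source hy2)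
  have key : ∀ u u' : TangentSpace 𝓘(ℝ, V) x,
      mvfderiv 𝓘(ℝ, V) (fun z => mvfderiv 𝓘(ℝ, V) f z (coordField x u z)) y (coordField x u' y) =
        fderiv ℝ (fderiv ℝ g) (chartAt V x y) u' u := by
    intro u u'
    rw [mvfderiv_coordField (contMDiff_mvfderiv_apply hf (contMDiff_coordField x u)) hy1 hy2]
    have h1 : ((fun z => mvfderiv 𝓘(ℝ, V) f z (coordField x u z)) ∘ (chartAt V x).symm)
        =ᶠ[𝓝 (chartAt V x y)] fun p => fderiv ℝ g p u := by
      have h2 : ∀ᶠ p in 𝓝 (chartAt V x y), cutoff (V := V) x ((chartAt V x).symm p) = 1 ∧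
          (chartAt V x).symm p ∈ (chartAt V x).source := by
        refine hcont.eventually (p := fun z => cutoff (V := V) x z = 1 ∧
          z ∈ (chartAt V x).source) ?_
        rw [hinv]
        exact hy
      filter_upwards [h2, (chartAt V x).open_target.mem_nhds ((chartAt V x).map_source hy2)]
        with p hp hp'
      simp only [Function.comp_apply]
      rw [mvfderiv_coordField hf hp.1 hp.2, (chartAt V x).right_inv hp']
    rw [h1.fderiv_eq]
    have h3 : DifferentiableAt ℝ (fderiv ℝ g) (chartAt V x y) :=
      (hgs.fderiv_right (m := 1) (by norm_cast)).differentiableAt (by simp)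
    have h4 := (h3.hasFDerivAt.clm_apply (hasFDerivAt_const (u : V) _)).fderiv
    rw [h4]
    change fderiv ℝ g _ (0 : V) + _ = _
    rw [map_zero, zero_add]
    rfl
  rw [key, key]
  exact (hgs.isSymmSndFDerivAt (by simp; norm_cast)).eq _ _


/-! ### Holomorphic coordinate functions -/

/-- The pull-back of a linear function by the chart at `y`, cut off away from `y`. -/
def coordFun (y : Y) (l : V →L[ℂ] ℂ) (z : Y) : ℂ :=
  cutoff (V := V) y z • l (chartAt V y z)

lemma contMDiff_coordFun (y : Y) (l : V →L[ℂ] ℂ) :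
    ContMDiff 𝓘(ℝ, V) 𝓘(ℝ, ℂ) ∞ (coordFun y l) := by
  refine contMDiff_of_tsupport fun z hz => ?_
  have hz' : z ∈ (chartAt V y).source :=
    (cutoff (V := V) y).tsupport_subset_chartAt_source (tsupport_smul_subset_left _ _ hz)
  have h1 : ContMDiffAt 𝓘(ℝ, V) 𝓘(ℝ, V) ∞ (chartAt V y) z :=
    contMDiffAt_of_mem_maximalAtlas (IsManifold.chart_mem_maximalAtlas y) hz'
  exact (cutoff (V := V) y).contMDiff.contMDiffAt.smul
    ((l.restrictScalars ℝ).contDiff.contMDiff.contMDiffAt.comp z h1)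

lemma mvfderiv_coordFun {y z : Y} (hz : IsFlatNear (V := V) y z) (l : V →L[ℂ] ℂ)
    (X : TangentSpace 𝓘(ℝ, V) z) :
    mvfderiv 𝓘(ℝ, V) (coordFun y l) z X =
      l (((trivializationAt V (TangentSpace 𝓘(ℝ, V) : Y → Type _) y).continuousLinearMapAt ℝ z X
        : V)) := by
  have hz' := hz.self_of_nhds.2
  have h1 : coordFun y l =ᶠ[𝓝 z] fun z' => l (chartAt V y z') := by
    filter_upwards [hz] with z' hz'
    rw [coordFun, hz'.1, one_smul]
  have h2 : HasMFDerivAt 𝓘(ℝ, V) 𝓘(ℝ, V) (chartAt V y) z (mfderiv 𝓘(ℝ, V) 𝓘(ℝ, V) (chartAt V y) z) :=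
    (mdifferentiableAt_atlas (chart_mem_atlas V y) hz').hasMFDerivAt
  have h3 : HasMFDerivAt 𝓘(ℝ, V) 𝓘(ℝ, ℂ) l (chartAt V y z) (l.restrictScalars ℝ) :=
    (l.restrictScalars ℝ).hasFDerivAt.hasMFDerivAt
  have h4 := (h3.comp z h2).congr_of_eventuallyEq h1
  have h5 := TangentBundle.continuousLinearMapAt_trivializationAt (I := 𝓘(ℝ, V)) (𝕜 := ℝ) hz'
  simp only [mfld_simps] at h5
  rw [h5]
  exact congrArg (fun l => l X) h4.mfderiv

omit [T2Space Y] in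
lemma continuousLinearMapAt_tangentJ {y z : Y} (hz : z ∈ (chartAt V y).source)
    (X : TangentSpace 𝓘(ℝ, V) z) :
    ((trivializationAt V (TangentSpace 𝓘(ℝ, V) : Y → Type _) y).continuousLinearMapAt ℝ z
      (tangentJ z X) : V) = Complex.I •
    ((trivializationAt V (TangentSpace 𝓘(ℝ, V) : Y → Type _) y).continuousLinearMapAt ℝ z X : V) := by
  rw [TangentBundle.continuousLinearMapAt_trivializationAt_eq_core hz]
  exact tangentCoordChange_I_smul (mem_chart_source V z) hz X

lemma delbar_coordFun {y z : Y} (hz : IsFlatNear (V := V) y z) (l : V →L[ℂ] ℂ) :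
    delbar (V := V) (coordFun y l) z = 0 := by
  ext X
  rw [delbar, part01_apply, mvfderiv_coordFun hz, mvfderiv_coordFun hz,
    continuousLinearMapAt_tangentJ hz.self_of_nhds.2, map_smul, smul_smul, Complex.I_mul_I]
  simp

/-- The expansion of a complex linear covector in the coordinates around `y`. -/
lemma apply_eq_sum_coordField {W : Type*} [AddCommGroup W] [Module ℂ W] [TopologicalSpace W]
    {y z : Y} (hz : IsFlatNear (V := V) y z) (l : TangentSpace 𝓘(ℝ, V) z →L[ℝ] W)
    (hl : ∀ X, l (tangentJ z X) = Complex.I • l X) {ι : Type*} [Fintype ι]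
    (b : Module.Basis ι ℂ V) (X : TangentSpace 𝓘(ℝ, V) z) :
    l X = ∑ i, mvfderiv 𝓘(ℝ, V) (coordFun y (b.coord i).toContinuousLinearMap) z X •
      l (coordField y (b i : V) z) := by
  obtain ⟨hz1, hz2⟩ := hz.self_of_nhds
  set e := trivializationAt V (TangentSpace 𝓘(ℝ, V) : Y → Type _) y with he
  have hze : z ∈ e.baseSet := hz2
  -- Read in the chart at `y`, `l` becomes a map on `V`. Compatibility with multiplication by I
  -- makes it complex linear, so it can be expanded in the complex basis `b`.
  let m : V →ₗ[ℂ] W :=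
    { toFun := fun v => l (e.symmL ℝ z v)
      map_add' := fun v w => by rw [map_add, map_add]
      map_smul' := fun c v => by
        have h1 : e.symmL ℝ z (Complex.I • v) = tangentJ z (e.symmL ℝ z v) := by
          rw [TangentBundle.symmL_trivializationAt_eq_core hz2]
          exact tangentCoordChange_I_smul hz2 (mem_chart_source V z) v
        have h2 : c • v = c.re • v + c.im • (Complex.I • v) := by
          conv_lhs => rw [← Complex.re_add_im c]
          rw [add_smul, mul_smul]
          simp
        rw [h2, map_add, map_add, map_smul, map_smul, map_smul, map_smul, h1, hl]
        conv_rhs => rw [RingHom.id_apply, ← Complex.re_add_im c, add_smul, mul_smul]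
        simp }
  have h3 : l X = m (e.continuousLinearMapAt ℝ z X) := by
    change _ = l _
    rw [e.symmL_continuousLinearMapAt hze]
  rw [h3, ← b.sum_repr (e.continuousLinearMapAt ℝ z X : V), map_sum]
  refine Finset.sum_congr rfl fun i _ => ?_
  change _ = _ • l (cutoff (V := V) y z • e.symmL ℝ z (b i))
  rw [map_smul, mvfderiv_coordFun hz, hz1, one_smul]
  congr 1

variable {F : Type*} [NormedAddCommGroup F] [NormedSpace ℂ F]
  {E : Y → Type*} [∀ x, AddCommGroup (E x)] [∀ x, Module ℂ (E x)] [∀ x, TopologicalSpace (E x)]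
  [∀ x, IsTopologicalAddGroup (E x)] [∀ x, ContinuousSMul ℂ (E x)]
  [TopologicalSpace (TotalSpace F E)] [FiberBundle F E] [VectorBundle ℂ F E]
  [FiniteDimensional ℂ F] [ContMDiffVectorBundle ∞ F E 𝓘(ℝ, V)]

/-! ### Smoothness of sections -/

lemma contMDiffAt_matrix_det {n : Type*} [Fintype n] [DecidableEq n] {M : Y → Matrix n n ℝ} {x : Y}
    (hM : ∀ i j, ContMDiffAt 𝓘(ℝ, V) 𝓘(ℝ, ℝ) ∞ (fun y => M y i j) x) :
    ContMDiffAt 𝓘(ℝ, V) 𝓘(ℝ, ℝ) ∞ (fun y => (M y).det) x := by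
  simp only [Matrix.det_apply']
  exact ContMDiffAt.sum fun σ _ => contMDiffAt_const.mul (ContMDiffAt.prod fun i _ => hM _ _)

/-- The real part of a Hermitian metric, as a real bilinear form. -/
def HermitianMetric.reInner (h : HermitianMetric V F E) (x : Y) : E x →ₗ[ℝ] E x →ₗ[ℝ] ℝ :=
  LinearMap.mk₂ ℝ (fun v w => (h.inner x v w).re)
    (fun v v' w => by simp) (fun c v w => by simp [← Complex.coe_smul])
    (fun v w w' => by simp) (fun c v w => by simp [← Complex.coe_smul])

lemma HermitianMetric.reInner_apply (h : HermitianMetric V F E) (x : Y) (v w : E x) :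
    h.reInner x v w = (h.inner x v w).re := rfl

/-- A set-theoretic section whose pairing with every smooth section is smooth is itself smooth. -/
lemma HermitianMetric.isSmoothSection_of_inner (h : HermitianMetric V F E) {t : ∀ x, E x}
    (ht : ∀ u, IsSmoothSection V F u →
      ContMDiff 𝓘(ℝ, V) 𝓘(ℝ, ℂ) ∞ fun y => h.inner y (t y) (u y)) :
    IsSmoothSection V F t := by
  classical
  intro x
  set e := trivializationAt F E x with he
  have hx : x ∈ e.baseSet := FiberBundle.mem_baseSet_trivializationAt' x
  let b := Module.finBasis ℝ F
  obtain ⟨χ, -, hχ⟩ := (SmoothBumpFunction.nhds_basis_tsupport (I := 𝓘(ℝ, V)) x).mem_iff.1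
    (e.open_baseSet.mem_nhds hx)
  have : ContMDiffVectorBundle 1 F E 𝓘(ℝ, V) := .of_le (n := ∞) (by norm_cast)
  let S : Fin (Module.finrank ℝ F) → ∀ y, E y := fun i => (χ : Y → ℝ) • e.localFrame b i
  have hS : ∀ i, IsSmoothSection V F (S i) := fun i =>
    ContMDiffOn.smul_section_of_tsupport (χ.contMDiff.contMDiffOn) e.open_baseSet hχ
      (e.contMDiffOn_localFrame_baseSet (I := 𝓘(ℝ, V)) ∞ b i)
  -- The Gram matrix of a real frame for the real part of the metric. The coefficients of `t` in the
  -- frame solve a linear system with matrix `g` and smooth right-hand side `r`, and Cramer's rule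
  -- shows that they are smooth.
  let g : Y → Matrix (Fin (Module.finrank ℝ F)) (Fin (Module.finrank ℝ F)) ℝ :=
    fun y i j => (h.inner y (S i y) (S j y)).re
  have hg : ∀ i j, ContMDiff 𝓘(ℝ, V) 𝓘(ℝ, ℝ) ∞ (fun y => g y i j) := fun i j =>
    Complex.reCLM.contDiff.comp_contMDiff (h.smooth _ _ (hS i) (hS j))
  let r : Y → Fin (Module.finrank ℝ F) → ℝ := fun y j => (h.inner y (t y) (S j y)).re
  have hr : ∀ j, ContMDiff 𝓘(ℝ, V) 𝓘(ℝ, ℝ) ∞ (fun y => r y j) := fun j =>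
    Complex.reCLM.contDiff.comp_contMDiff (ht _ (hS j))
  have hev : ∀ᶠ y in 𝓝 x, χ y = 1 ∧ y ∈ e.baseSet :=
    χ.eventuallyEq_one.and (e.open_baseSet.mem_nhds hx)
  -- A null vector of the Gram matrix would give a nonzero combination of the frame of norm zero.
  have hdet : ∀ y, χ y = 1 → y ∈ e.baseSet → (g y).det ≠ 0 := by
    intro y hy1 hy2 hd
    obtain ⟨c, hc, hcg⟩ := Matrix.exists_vecMul_eq_zero_iff.2 hd
    have hSy : ∀ i, S i y = e.basisAt b hy2 i := fun i => by simp [S, hy1, hy2]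
    have h1 : ∑ i, c i • S i y ≠ 0 := by
      intro h0
      simp only [hSy] at h0
      exact hc (funext fun i => Fintype.linearIndependent_iff.1
        (e.basisAt b hy2).linearIndependent c h0 i)
    refine (h.pos y _ h1).ne' ?_
    rw [← h.reInner_apply]
    refine (map_sum (h.reInner y (∑ i, c i • S i y)) _ _).trans (Finset.sum_eq_zero fun j _ => ?_)
    have := congrFun hcg j
    simp only [Matrix.vecMul, dotProduct, g, Pi.zero_apply, ← h.reInner_apply] at this
    rw [map_smul, map_sum, LinearMap.sum_apply]
    simp only [map_smul, LinearMap.smul_apply, smul_eq_mul]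
    rw [this, mul_zero]
  rw [show (fun x => TotalSpace.mk' F x (t x)) = fun x => (⟨x, t x⟩ : TotalSpace F E) from rfl,
    contMDiffAt_iff_localFrameCoeff b hx]
  intro i
  have hform : ∀ᶠ y in 𝓝 x, (LinearMap.piApply (e.localFrameCoeff 𝓘(ℝ, V) b i)) t y =
      ((g y).det)⁻¹ * ∑ j, r y j * (g y).adjugate j i := by
    filter_upwards [hev] with y ⟨hy1, hy2⟩
    have hSy : ∀ i, S i y = e.localFrame b i y := fun i => by simp [S, hy1]
    set c : Fin (Module.finrank ℝ F) → ℝ := fun i => e.localFrameCoeff 𝓘(ℝ, V) b i y (t y) with hc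
    have h1 : r y = Matrix.vecMul c (g y) := by
      funext j
      simp only [r, Matrix.vecMul, dotProduct, g, ← h.reInner_apply]
      conv_lhs => rw [e.eq_sum_localFrameCoeff_smul (I := 𝓘(ℝ, V)) (b := b) (s := t) hy2]
      rw [map_sum, LinearMap.sum_apply]
      simp only [map_smul, LinearMap.smul_apply, smul_eq_mul, hSy]
      rfl
    have h2 : Matrix.vecMul (r y) (g y).adjugate i = (g y).det * c i := by
      rw [h1, Matrix.vecMul_vecMul, Matrix.mul_adjugate, Matrix.vecMul_smul, Matrix.vecMul_one]
      rfl
    change c i = _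
    rw [eq_inv_mul_iff_mul_eq₀ (hdet y hy1 hy2), ← h2]
    rfl
  refine ContMDiffAt.congr_of_eventuallyEq ?_ hform
  have hinv : ContMDiffAt 𝓘(ℝ, V) 𝓘(ℝ, ℝ) ∞ (fun y => ((g y).det)⁻¹) x := by
    have h1 := contMDiffAt_matrix_det fun i j => (hg i j).contMDiffAt (x := x)
    exact ContDiffAt.comp_contMDiffAt (f := fun y => (g y).det) (g := Inv.inv)
      (contDiffAt_inv ℝ (hdet x χ.eq_one hx)) h1
  refine hinv.mul (ContMDiffAt.sum fun j _ => (hr j x).mul ?_)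
  simp only [Matrix.adjugate_apply]
  refine contMDiffAt_matrix_det fun k l => ?_
  simp only [Matrix.updateRow_apply]
  split_ifs
  · exact contMDiffAt_const
  · exact hg k l x

/-! ### Derivatives of functions along coordinate fields -/

lemma contMDiff_const_mul (c : ℂ) {f : Y → ℂ} (hf : ContMDiff 𝓘(ℝ, V) 𝓘(ℝ, ℂ) ∞ f) :
    ContMDiff 𝓘(ℝ, V) 𝓘(ℝ, ℂ) ∞ fun y => c * f y :=
  (c • ContinuousLinearMap.id ℝ ℂ : ℂ →L[ℝ] ℂ).contDiff.comp_contMDiff hf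

lemma contMDiff_del {f : Y → ℂ} (hf : ContMDiff 𝓘(ℝ, V) 𝓘(ℝ, ℂ) ∞ f) (x : Y)
    (v : TangentSpace 𝓘(ℝ, V) x) :
    ContMDiff 𝓘(ℝ, V) 𝓘(ℝ, ℂ) ∞ fun y => del f y (coordField x v y) := by
  simp only [del, part10_apply, smul_eq_mul, ← coordField_tangentJ]
  exact contMDiff_const_mul _ ((contMDiff_mvfderiv_apply hf (contMDiff_coordField x v)).sub
    (contMDiff_const_mul _ (contMDiff_mvfderiv_apply hf (contMDiff_coordField x _))))

variable (V Y) in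
/-- The space of smooth complex valued functions. -/
def smoothFunctions : Submodule ℂ (Y → ℂ) where
  carrier := {f | ContMDiff 𝓘(ℝ, V) 𝓘(ℝ, ℂ) ∞ f}
  add_mem' hf hg := ContMDiff.add hf hg
  zero_mem' := contMDiff_const
  smul_mem' c _ hf := contMDiff_const_mul c hf

lemma mdifferentiableAt_smoothFunctions (f : smoothFunctions V Y) (x : Y) :
    MDifferentiableAt 𝓘(ℝ, V) 𝓘(ℝ, ℂ) f.1 x := (f.2 x).mdifferentiableAt (by simp)

/-- The derivative of functions along a coordinate field. -/
def derivOp (x : Y) (v : TangentSpace 𝓘(ℝ, V) x) : smoothFunctions V Y →ₗ[ℂ] smoothFunctions V Y where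
  toFun f := ⟨fun y => mvfderiv 𝓘(ℝ, V) f.1 y (coordField x v y),
    contMDiff_mvfderiv_apply f.2 (contMDiff_coordField x v)⟩
  map_add' f g := Subtype.ext <| funext fun y => by
    have := mvfderiv_add (mdifferentiableAt_smoothFunctions f y)
      (mdifferentiableAt_smoothFunctions g y)
    exact congrArg (fun l => l (coordField x v y)) this
  map_smul' c f := Subtype.ext <| funext fun y => by
    have h1 := (mdifferentiableAt_smoothFunctions f y).hasMFDerivAt
    have h2 : HasMFDerivAt 𝓘(ℝ, ℂ) 𝓘(ℝ, ℂ) (fun z : ℂ => c * z) (f.1 y)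
      (c • ContinuousLinearMap.id ℝ ℂ : ℂ →L[ℝ] ℂ) :=
        ((c • ContinuousLinearMap.id ℝ ℂ : ℂ →L[ℝ] ℂ).hasFDerivAt).hasMFDerivAt
    exact congrArg (fun l => l (coordField x v y)) (h2.comp y h1).mfderiv

/-- `∂` along a coordinate field. -/
def delOp (x : Y) (v : TangentSpace 𝓘(ℝ, V) x) : smoothFunctions V Y →ₗ[ℂ] smoothFunctions V Y :=
  (1 / 2 : ℂ) • (derivOp x v - Complex.I • derivOp x (tangentJ x v))

/-- `∂̄` along a coordinate field. -/
def delbarOp (x : Y) (v : TangentSpace 𝓘(ℝ, V) x) : smoothFunctions V Y →ₗ[ℂ] smoothFunctions V Y :=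
  (1 / 2 : ℂ) • (derivOp x v + Complex.I • derivOp x (tangentJ x v))

lemma delOp_apply (x : Y) (v : TangentSpace 𝓘(ℝ, V) x) (f : smoothFunctions V Y) (y : Y) :
    (delOp x v f).1 y = del f.1 y (coordField x v y) := by
  rw [del, part10_apply, ← coordField_tangentJ]; rfl

lemma delbarOp_apply (x : Y) (v : TangentSpace 𝓘(ℝ, V) x) (f : smoothFunctions V Y) (y : Y) :
    (delbarOp x v f).1 y = delbar f.1 y (coordField x v y) := by
  rw [delbar, part01_apply, ← coordField_tangentJ]; rfl

lemma derivOp_comm {x y : Y} (hy : IsFlatNear (V := V) x y) (v w : TangentSpace 𝓘(ℝ, V) x)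
    (f : smoothFunctions V Y) :
    (derivOp x v (derivOp x w f)).1 y = (derivOp x w (derivOp x v f)).1 y :=
  mvfderiv_coordField_comm f.2 hy v w

variable (V) in
/-- Evaluation of smooth functions at a point. -/
def evalFun (y : Y) : smoothFunctions V Y →ₗ[ℂ] ℂ := (LinearMap.proj y).comp (Submodule.subtype _)

lemma evalFun_apply (y : Y) (f : smoothFunctions V Y) : evalFun V y f = f.1 y := rfl

/-- `delOp` is a constant combination of derivatives along coordinate fields, because J applied to
such a field is again one; these derivatives commute. -/
lemma delOp_comm {x y : Y} (hy : IsFlatNear (V := V) x y) (v w : TangentSpace 𝓘(ℝ, V) x)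
    (f : smoothFunctions V Y) :
    evalFun V y (delOp x v (delOp x w f)) = evalFun V y (delOp x w (delOp x v f)) := by
  have h := fun v w => derivOp_comm hy v w f
  simp only [← evalFun_apply] at h
  simp only [delOp, LinearMap.smul_apply, LinearMap.sub_apply, map_smul, map_sub]
  rw [h v w, h v _, h _ w, h _ (tangentJ x w)]
  module

lemma delbarOp_comm {x y : Y} (hy : IsFlatNear (V := V) x y) (v w : TangentSpace 𝓘(ℝ, V) x)
    (f : smoothFunctions V Y) :
    evalFun V y (delbarOp x v (delbarOp x w f)) = evalFun V y (delbarOp x w (delbarOp x v f)) := by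
  have h := fun v w => derivOp_comm hy v w f
  simp only [← evalFun_apply] at h
  simp only [delbarOp, LinearMap.smul_apply, LinearMap.add_apply, map_smul, map_add]
  rw [h v w, h v _, h _ w, h _ (tangentJ x w)]
  module

lemma delOp_delbarOp_comm {x y : Y} (hy : IsFlatNear (V := V) x y) (v w : TangentSpace 𝓘(ℝ, V) x)
    (f : smoothFunctions V Y) :
    evalFun V y (delOp x v (delbarOp x w f)) = evalFun V y (delbarOp x w (delOp x v f)) := by
  have h := fun v w => derivOp_comm hy v w f
  simp only [← evalFun_apply] at h
  simp only [delOp, delbarOp, LinearMap.smul_apply, LinearMap.add_apply, map_smul, map_add,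
    LinearMap.sub_apply, map_sub]
  rw [h v w, h v _, h _ w, h _ (tangentJ x w)]
  module

/-! ### First order operators on sections -/

variable (V F E) in
/-- The space of smooth sections. -/
def smoothSections : Submodule ℂ (∀ x, E x) where
  carrier := {s | IsSmoothSection V F s}
  add_mem' hf hg := ContMDiff.add_section hf hg
  zero_mem' := contMDiff_zeroSection ℝ E
  smul_mem' c _ hf := IsSmoothSection.smul (f := fun _ => c) contMDiff_const hf

variable (F) in
/-- `T` is an operator `A⁰(E) → A¹(E)` with `T (f s) = f T s + (a ∂f + b ∂̄f) ⊗ s`. -/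
structure IsFirstOrder (a b : ℂ) (T : (∀ x, E x) → Form1 V E) : Prop where
  smooth : ∀ s, IsSmoothSection V F s → ∀ x (v : TangentSpace 𝓘(ℝ, V) x),
    IsSmoothSection V F fun y => T s y (coordField x v y)
  add : ∀ s t, IsSmoothSection V F s → IsSmoothSection V F t → T (s + t) = T s + T t
  leibniz : ∀ (f : Y → ℂ) (s : ∀ x, E x), ContMDiff 𝓘(ℝ, V) 𝓘(ℝ, ℂ) ∞ f →
    IsSmoothSection V F s → ∀ x (X : TangentSpace 𝓘(ℝ, V) x),
      T (fun y => f y • s y) x X = f x • T s x X + (a * del f x X + b * delbar f x X) • s x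

namespace IsFirstOrder

variable {a b : ℂ} {T : (∀ x, E x) → Form1 V E} (hT : IsFirstOrder F a b T)

lemma del_const (c : ℂ) (x : Y) : del (V := V) (fun _ : Y => c) x = 0 := by
  ext X; simp [del, part10_apply, mvfderiv_const]

lemma delbar_const (c : ℂ) (x : Y) : delbar (V := V) (fun _ : Y => c) x = 0 := by
  ext X; simp [delbar, part01_apply, mvfderiv_const]

include hT in
lemma smul_const (c : ℂ) {s : ∀ x, E x} (hs : IsSmoothSection V F s) :
    T (c • s) = fun x => c • T s x := by
  funext x
  ext X
  have := hT.leibniz (fun _ => c) s contMDiff_const hs x X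
  simp only [del_const, delbar_const, _root_.zero_apply, mul_zero, add_zero, zero_smul] at this
  exact this

/-- The action of `T` along a coordinate field. -/
def op (x : Y) (v : TangentSpace 𝓘(ℝ, V) x) : smoothSections V F E →ₗ[ℂ] smoothSections V F E where
  toFun s := ⟨fun y => T s y (coordField x v y), hT.smooth s s.2 x v⟩
  map_add' s t := Subtype.ext <| funext fun y =>
    congrArg (fun α => α y (coordField x v y)) (hT.add s t s.2 t.2)
  map_smul' c s := Subtype.ext <| funext fun y =>
    congrArg (fun α => α y (coordField x v y)) (hT.smul_const c s.2)

end IsFirstOrder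

variable (V F) in
/-- Evaluation of smooth sections at a point. -/
def evalSec (y : Y) : smoothSections V F E →ₗ[ℂ] E y := (LinearMap.proj y).comp (Submodule.subtype _)


/-! ### The operators d', d'', δ', δ'': symbols and types -/

namespace LambdaConnection

variable {lam : ℂ} (D : LambdaConnection V F E lam) (h : HermitianMetric V F E)

lemma isSmoothSection_apply {s : ∀ x, E x} (hs : IsSmoothSection V F s) (x : Y)
    (v : TangentSpace 𝓘(ℝ, V) x) : IsSmoothSection V F fun y => D.toFun s y (coordField x v y) :=
  ContMDiff.clm_bundle_apply (D.smooth s hs) (contMDiff_coordField x v)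

lemma isFirstOrder_dprime : IsFirstOrder F lam 0 D.dprime where
  smooth s hs x v := by
    simp only [dprime, part10_apply, ← coordField_tangentJ]
    exact (smoothSections V F E).smul_mem _ ((smoothSections V F E).sub_mem
      (D.isSmoothSection_apply hs x v)
      ((smoothSections V F E).smul_mem _ (D.isSmoothSection_apply hs x _)))
  add s t hs ht := by
    funext x
    simp only [dprime, D.add s t hs ht, Pi.add_apply, part10_add]
  leibniz f s hf hs x X := by
    rw [D.dprime_smul hf hs, zero_mul, add_zero]

lemma isFirstOrder_dbar : IsFirstOrder F 0 1 D.dbar where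
  smooth s hs x v := by
    simp only [dbar, part01_apply, ← coordField_tangentJ]
    exact (smoothSections V F E).smul_mem _ ((smoothSections V F E).add_mem
      (D.isSmoothSection_apply hs x v)
      ((smoothSections V F E).smul_mem _ (D.isSmoothSection_apply hs x _)))
  add s t hs ht := by
    funext x
    simp only [dbar, D.add s t hs ht, Pi.add_apply, part01_add]
  leibniz f s hf hs x X := by
    rw [D.dbar_smul hf hs, zero_mul, zero_add, one_mul]

lemma mdifferentiableAt_inner {s t : ∀ x, E x} (hs : IsSmoothSection V F s)
    (ht : IsSmoothSection V F t) (x : Y) :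
    MDifferentiableAt 𝓘(ℝ, V) 𝓘(ℝ, ℂ) (fun y => h.inner y (s y) (t y)) x :=
  (h.smooth s t hs ht x).mdifferentiableAt (by simp)

/-- δ' is chosen point by point, so its smoothness has to be recovered from its pairings with smooth
sections, which the defining identity expresses through smooth functions. Additivity and the Leibniz
rule follow from uniqueness. -/
lemma isFirstOrder_deltaPrime : IsFirstOrder F 1 0 (D.deltaPrime h) where
  smooth s hs x v := h.isSmoothSection_of_inner fun u hu => by
    have h1 : ∀ y, h.inner y (D.deltaPrime h s y (coordField x v y)) (u y) =
        del (fun y => h.inner y (s y) (u y)) y (coordField x v y) -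
          h.inner y (s y) (D.dbar u y (coordField x v y)) := fun y => by
      rw [D.deltaPrime_spec h hs y u hu, add_sub_cancel_right]
    simp only [h1]
    exact (contMDiff_del (h.smooth s u hs hu) x v).sub
      (h.smooth s _ hs (D.isFirstOrder_dbar.smooth u hu x v))
  add s t hs ht := by
    funext x
    refine IsDeltaPrimeAt.unique D h
      (D.deltaPrime_spec h ((smoothSections V F E).add_mem hs ht) x) fun u hu X => ?_
    simp only [Pi.add_apply, map_add, LinearMap.add_apply, _root_.add_apply]
    rw [del_add (mdifferentiableAt_inner h hs hu x) (mdifferentiableAt_inner h ht hu x),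
      _root_.add_apply, D.deltaPrime_spec h hs x u hu, D.deltaPrime_spec h ht x u hu]
    ring
  leibniz f s hf hs x X := by
    have h1 : D.deltaPrime h (fun y => f y • s y) x =
        f x • D.deltaPrime h s x + (del f x).smulRight (s x) := by
      refine IsDeltaPrimeAt.unique D h (D.deltaPrime_spec h (IsSmoothSection.smul hf hs) x)
        fun u hu X => ?_
      simp only [map_smul, LinearMap.smul_apply, smul_eq_mul]
      rw [del_mul ((hf x).mdifferentiableAt (by simp)) (mdifferentiableAt_inner h hs hu x),
        D.deltaPrime_spec h hs x u hu]
      simp only [_root_.add_apply, _root_.smul_apply, ContinuousLinearMap.smulRight_apply, map_add,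
        map_smul, LinearMap.add_apply, LinearMap.smul_apply, smul_eq_mul]
      ring
    rw [h1, one_mul, zero_mul, add_zero]
    rfl

/-- The symbol is conj(λ) ∂̄ because a factor `f` of the second argument leaves the metric as
conj(f), and λ ∂(conj f) is the conjugate of conj(λ) ∂̄f. -/
lemma isFirstOrder_deltaDoublePrime : IsFirstOrder F 0 (conj lam) (D.deltaDoublePrime h) where
  smooth s hs x v := h.isSmoothSection_of_inner fun u hu => by
    have h1 : ∀ y, h.inner y (D.deltaDoublePrime h s y (coordField x v y)) (u y) =
        conj (lam * del (fun y => h.inner y (u y) (s y)) y (coordField x v y) -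
          h.inner y (D.dprime u y (coordField x v y)) (s y)) := fun y => by
      rw [D.deltaDoublePrime_spec h hs y u hu, add_sub_cancel_left, ← h.conj_symm]
    simp only [h1]
    exact Complex.conjCLE.contDiff.comp_contMDiff
      ((contMDiff_const_mul lam (contMDiff_del (h.smooth u s hu hs) x v)).sub
      (h.smooth _ s (D.isFirstOrder_dprime.smooth u hu x v) hs))
  add s t hs ht := by
    funext x
    refine IsDeltaDoublePrimeAt.unique D h
      (D.deltaDoublePrime_spec h ((smoothSections V F E).add_mem hs ht) x) fun u hu X => ?_
    simp only [Pi.add_apply, map_add, _root_.add_apply]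
    rw [del_add (mdifferentiableAt_inner h hu hs x) (mdifferentiableAt_inner h hu ht x),
      _root_.add_apply, mul_add, D.deltaDoublePrime_spec h hs x u hu,
      D.deltaDoublePrime_spec h ht x u hu]
    ring
  leibniz f s hf hs x X := by
    have hfd := (hf x).mdifferentiableAt (by simp : (∞ : ℕ∞ω) ≠ 0)
    have hcf : MDifferentiableAt 𝓘(ℝ, V) 𝓘(ℝ, ℂ) (fun y => conj (f y)) x :=
      (Complex.conjCLE.contDiff.comp_contMDiff hf x).mdifferentiableAt
        (by simp : (∞ : ℕ∞ω) ≠ 0)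
    have h1 : D.deltaDoublePrime h (fun y => f y • s y) x =
        f x • D.deltaDoublePrime h s x + conj lam • (delbar f x).smulRight (s x) := by
      refine IsDeltaDoublePrimeAt.unique D h
        (D.deltaDoublePrime_spec h (IsSmoothSection.smul hf hs) x) fun u hu X => ?_
      simp only [LinearMap.map_smulₛₗ, smul_eq_mul]
      rw [del_mul hcf (mdifferentiableAt_inner h hu hs x), del_conj hfd, mul_add,
        mul_left_comm, D.deltaDoublePrime_spec h hs x u hu]
      simp only [_root_.add_apply, _root_.smul_apply, ContinuousLinearMap.smulRight_apply, map_add,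
        LinearMap.map_smulₛₗ, smul_eq_mul,
        Complex.conj_conj]
      ring
    rw [h1, zero_mul, zero_add, mul_smul]
    rfl

lemma dprime_tangentJ (s : ∀ x, E x) (x : Y) (X : TangentSpace 𝓘(ℝ, V) x) :
    D.dprime s x (tangentJ x X) = Complex.I • D.dprime s x X := by
  simp only [dprime, part10_apply, tangentJ_tangentJ, map_neg]
  match_scalars <;> first | ring1 | linear_combination (1 / 2 : ℂ) * Complex.I_sq

lemma dbar_tangentJ (s : ∀ x, E x) (x : Y) (X : TangentSpace 𝓘(ℝ, V) x) :
    D.dbar s x (tangentJ x X) = -(Complex.I • D.dbar s x X) := by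
  simp only [dbar, part01_apply, tangentJ_tangentJ, map_neg]
  match_scalars <;> first | ring1 | linear_combination (1 / 2 : ℂ) * Complex.I_sq

omit [FiniteDimensional ℂ V] [IsManifold 𝓘(ℂ, V) ω Y] [T2Space Y] in
lemma del_tangentJ (f : Y → ℂ) (x : Y) (X : TangentSpace 𝓘(ℝ, V) x) :
    del f x (tangentJ x X) = Complex.I * del f x X := by
  simp only [del, part10_apply, tangentJ_tangentJ, map_neg, smul_eq_mul]
  linear_combination (1 / 2 : ℂ) * mvfderiv 𝓘(ℝ, V) f x (tangentJ x X) * Complex.I_sq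

/-- The type of δ' is not part of its definition but is forced by it: ∂ has type (1,0), and the
(0,1)-operator d'' becomes complex linear in the tangent vector once it sits in the conjugate linear
slot. -/
lemma deltaPrime_tangentJ {s : ∀ x, E x} (hs : IsSmoothSection V F s) (x : Y)
    (X : TangentSpace 𝓘(ℝ, V) x) :
    D.deltaPrime h s x (tangentJ x X) = Complex.I • D.deltaPrime h s x X := by
  refine h.ext_left x fun w => ?_
  obtain ⟨u, hu, rfl⟩ := exists_section (V := V) (F := F) x w
  have h1 := D.deltaPrime_spec h hs x u hu X
  have h2 := D.deltaPrime_spec h hs x u hu (tangentJ x X)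
  rw [del_tangentJ, dbar_tangentJ, map_neg, LinearMap.map_smulₛₗ, Complex.conj_I] at h2
  rw [map_smul, LinearMap.smul_apply]
  simp only [smul_eq_mul] at h2 ⊢
  linear_combination -h2 + Complex.I * h1

lemma deltaDoublePrime_tangentJ {s : ∀ x, E x} (hs : IsSmoothSection V F s) (x : Y)
    (X : TangentSpace 𝓘(ℝ, V) x) :
    D.deltaDoublePrime h s x (tangentJ x X) = -(Complex.I • D.deltaDoublePrime h s x X) := by
  refine h.ext_left x fun w => ?_
  obtain ⟨u, hu, rfl⟩ := exists_section (V := V) (F := F) x w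
  rw [h.conj_symm x (u x), h.conj_symm x (u x)]
  congr 1
  have h1 := D.deltaDoublePrime_spec h hs x u hu X
  have h2 := D.deltaDoublePrime_spec h hs x u hu (tangentJ x X)
  rw [del_tangentJ, dprime_tangentJ, map_smul, LinearMap.smul_apply] at h2
  rw [map_neg, LinearMap.map_smulₛₗ, Complex.conj_I]
  simp only [smul_eq_mul] at h2 ⊢
  linear_combination -h2 + Complex.I * h1

end LambdaConnection

/-! ### Linear algebra -/

section LinearAlgebra

variable {M : Type*} [AddCommGroup M] [Module ℂ M]

/-- Separation of types: the hypotheses are the values of a two-form at (v, w), (Jv, w), (v, Jw) and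
(Jv, Jw), where `a`, `b`, `c`, `d` are its components with J-eigenvalues (i, i), (i, -i), (-i, i)
and (-i, -i). -/
lemma eq_zero_of_types {a b c d : M} (h1 : a + b + c + d = 0)
    (h2 : Complex.I • a + Complex.I • b - Complex.I • c - Complex.I • d = 0)
    (h3 : Complex.I • a - Complex.I • b + Complex.I • c - Complex.I • d = 0)
    (h4 : -a + b + c - d = 0) : a = 0 ∧ b = 0 ∧ c = 0 ∧ d = 0 := by
  have h5 : a = (1 / 4 : ℂ) • ((a + b + c + d) - (-a + b + c - d)) - (Complex.I / 4) •
      ((Complex.I • a + Complex.I • b - Complex.I • c - Complex.I • d) +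
        (Complex.I • a - Complex.I • b + Complex.I • c - Complex.I • d)) := by
    match_scalars <;> first | ring1 | linear_combination (1 / 2 : ℂ) * Complex.I_sq |
      linear_combination -(1 / 2 : ℂ) * Complex.I_sq
  have h6 : a = 0 := by rw [h5, h1, h2, h3, h4]; simp
  subst h6
  have h7 : d = 0 := by
    have : d = (1 / 2 : ℂ) • (((0 : M) + b + c + d) - (-0 + b + c - d)) := by module
    rw [this, h1, h4]; simp
  subst h7
  have h8 : b = (1 / 2 : ℂ) • ((0 + b + c + 0) - Complex.I •
      (Complex.I • (0 : M) + Complex.I • b - Complex.I • c - Complex.I • (0 : M))) := by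
    match_scalars <;> first | ring1 | linear_combination (1 / 2 : ℂ) * Complex.I_sq |
      linear_combination -(1 / 2 : ℂ) * Complex.I_sq
  have h9 : b = 0 := by rw [h8, h1, h2]; simp
  subst h9
  exact ⟨rfl, rfl, by simpa using h1, rfl⟩

/-- Used with `e` the evaluation of sections at a point, to turn a tensorial operator into an
endomorphism of the fibre. -/
lemma exists_factor {N : Type*} [AddCommGroup N] [Module ℂ N] {e : N →ₗ[ℂ] M}
    (he : Function.Surjective e) (A : N →ₗ[ℂ] M) (hA : ∀ s, e s = 0 → A s = 0) :
    ∃ A' : M →ₗ[ℂ] M, ∀ s, A' (e s) = A s := by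
  obtain ⟨g, hg⟩ := e.exists_rightInverse_of_surjective (LinearMap.range_eq_top.2 he)
  refine ⟨A ∘ₗ g, fun s => ?_⟩
  rw [← sub_eq_zero, LinearMap.comp_apply, ← map_sub]
  refine hA _ ?_
  rw [map_sub, sub_eq_zero]
  exact LinearMap.congr_fun hg (e s)

/-- If the commutator of the adjoints of `a` and `c` commutes with `a` and `c`, then
`a` and `c` commute. -/
lemma commute_of_commute_adjoint_commutator [FiniteDimensional ℂ M] (B : M →ₗ[ℂ] M →ₗ⋆[ℂ] ℂ)
    (hsymm : ∀ u v, B v u = conj (B u v)) (hpos : ∀ u, u ≠ 0 → 0 < (B u u).re)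
    {a c a' c' : M →ₗ[ℂ] M} (ha : ∀ u v, B (a u) v = B u (a' v))
    (hc : ∀ u v, B (c u) v = B u (c' v))
    (h1 : ∀ u, a (a' (c' u) - c' (a' u)) = a' (c' (a u)) - c' (a' (a u)))
    (h2 : ∀ u, c (a' (c' u) - c' (a' u)) = a' (c' (c u)) - c' (a' (c u))) :
    (∀ u, a (c u) = c (a u)) ∧ ∀ u, a' (c' u) = c' (a' u) := by
  -- The arguments are exchanged since `inner` is conjugate linear in its first variable and `B` in
  -- its second.
  let core : InnerProductSpace.Core ℂ M :=
    { inner := fun u v => B v u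
      conj_inner_symm := fun u v => by rw [← hsymm]
      re_inner_nonneg := fun u => by
        by_cases hu : u = 0
        · simp [hu]
        · exact (hpos u hu).le
      add_left := fun u v w => by simp
      smul_left := fun u v r => by simp
      definite := fun u hu => by
        by_contra hne
        have := hpos u hne
        rw [hu] at this
        simp at this }
  let _ : NormedAddCommGroup M := core.toNormedAddCommGroup
  let _ : InnerProductSpace ℂ M := InnerProductSpace.ofCore core.toCore
  have hB : ∀ u v : M, inner ℂ u v = B v u := fun u v => rfl
  let n : Module.End ℂ M := a * c - c * a
  let m : Module.End ℂ M := a' * c' - c' * a'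
  have hma : a * m = m * a := LinearMap.ext h1
  have hmc : c * m = m * c := LinearMap.ext h2
  have hnm : ∀ u v, B (n u) v = -B u (m v) := by
    intro u v
    simp only [n, m, LinearMap.sub_apply, Module.End.mul_apply, map_sub, ha, hc]
    ring
  -- Since `m` commutes with `c`, the product `m * n` is the commutator of `m * a` and `c`.
  have htr : LinearMap.trace ℂ M (m * n) = 0 := by
    have h3 : m * n = (m * a) * c - c * (m * a) := by
      simp only [n, mul_sub, ← mul_assoc, hmc]
    rw [h3, map_sub, LinearMap.trace_mul_comm, sub_self]
  -- By `hnm`, `m` is minus the adjoint of `n`, so the trace of `m * n` is minus the squared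
  -- Hilbert–Schmidt norm of `n`.
  have hsum : ∑ i, ‖n (stdOrthonormalBasis ℂ M i)‖ ^ 2 = 0 := by
    rw [LinearMap.trace_eq_sum_inner _ (stdOrthonormalBasis ℂ M)] at htr
    have h4 : ∀ u, inner ℂ u ((m * n) u) = -((‖n u‖ ^ 2 : ℝ) : ℂ) := by
      intro u
      have h5 := inner_self_eq_norm_sq_to_K (𝕜 := ℂ) (n u)
      rw [hB, hnm, hsymm] at h5
      rw [hB, Module.End.mul_apply]
      have h6 := congrArg conj h5
      simp only [map_neg, Complex.conj_conj] at h6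
      push_cast
      rw [eq_comm, neg_eq_iff_eq_neg, h6]
      simp
    simp only [h4, Finset.sum_neg_distrib, neg_eq_zero, ← Complex.ofReal_sum] at htr
    exact_mod_cast htr
  have hn : n = 0 := by
    refine (stdOrthonormalBasis ℂ M).toBasis.ext fun i => ?_
    have := (Finset.sum_eq_zero_iff_of_nonneg (fun i _ => by positivity)).1 hsum i (Finset.mem_univ i)
    simpa using this
  refine ⟨fun u => sub_eq_zero.1 (LinearMap.congr_fun hn u), fun u => ?_⟩
  by_contra hne
  have h7 := hpos _ (sub_ne_zero.2 hne)
  have h8 := hnm (a' (c' u) - c' (a' u)) u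
  rw [hn] at h8
  have h9 : B (a' (c' u) - c' (a' u)) (a' (c' u) - c' (a' u)) = 0 := by
    rw [LinearMap.zero_apply, map_zero, LinearMap.zero_apply, zero_eq_neg] at h8
    exact h8
  rw [h9] at h7
  simp at h7

end LinearAlgebra

/-! ### Brackets of operators -/

lemma evalSec_surjective (x : Y) : Function.Surjective (evalSec V F (E := E) x) := fun w => by
  obtain ⟨u, hu, rfl⟩ := exists_section (V := V) (F := F) x w
  exact ⟨⟨u, hu⟩, rfl⟩

variable (V F E) in
/-- The commutator of two operators, evaluated at a point. -/
def bracket (x : Y) : Module.End ℂ (smoothSections V F E) →ₗ[ℂ] Module.End ℂ (smoothSections V F E)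
    →ₗ[ℂ] smoothSections V F E →ₗ[ℂ] E x :=
  LinearMap.mk₂ ℂ (fun A B => evalSec V F x ∘ₗ (A * B - B * A))
    (fun A A' B => by ext; simp [add_mul, mul_add]; abel)
    (fun c A B => by ext; simp [smul_sub])
    (fun A A' B => by ext; simp [add_mul, mul_add]; abel)
    (fun c A B => by ext; simp [smul_sub])

lemma bracket_apply (x : Y) (A B : Module.End ℂ (smoothSections V F E)) (s : smoothSections V F E) :
    bracket V F E x A B s = evalSec V F x (A (B s)) - evalSec V F x (B (A s)) := by
  simp [bracket]

section

variable (x : Y) (A A' B : Module.End ℂ (smoothSections V F E))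

lemma bracket_neg_left : bracket V F E x (-A) B = -bracket V F E x A B := by
  ext s; simp [bracket_apply]; abel

lemma bracket_neg_right : bracket V F E x B (-A) = -bracket V F E x B A := by
  ext s; simp [bracket_apply]; abel

lemma bracket_sub_left : bracket V F E x (A - A') B = bracket V F E x A B - bracket V F E x A' B := by
  ext s; simp [bracket_apply]; abel

lemma bracket_sub_right :
    bracket V F E x B (A - A') = bracket V F E x B A - bracket V F E x B A' := by
  ext s; simp [bracket_apply]; abel

end

/-! ### First order operators: compositions, locality, change of coordinates -/

namespace IsFirstOrder

variable {a b a' b' : ℂ} {T T' : (∀ x, E x) → Form1 V E} (hT : IsFirstOrder F a b T)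
  (hT' : IsFirstOrder F a' b' T')

lemma evalSec_op (x y : Y) (v : TangentSpace 𝓘(ℝ, V) x) (s : smoothSections V F E) :
    evalSec V F y (hT.op x v s) = T s y (coordField x v y) := rfl

lemma evalSec_op_self (x : Y) (v : TangentSpace 𝓘(ℝ, V) x) (s : smoothSections V F E) :
    evalSec V F x (hT.op x v s) = T s x v := by rw [evalSec_op, coordField_self]

lemma comp_eq (s : smoothSections V F E) (x : Y) (v w : TangentSpace 𝓘(ℝ, V) x) :
    comp T T' s x v w = evalSec V F x (hT.op x v (hT'.op x w s)) -
      evalSec V F x (hT.op x w (hT'.op x v s)) := by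
  rw [evalSec_op_self, evalSec_op_self]
  rfl

lemma comp_self_eq (s : smoothSections V F E) (x : Y) (v w : TangentSpace 𝓘(ℝ, V) x) :
    comp T T s x v w = bracket V F E x (hT.op x v) (hT.op x w) s := by
  rw [hT.comp_eq hT, bracket_apply]

lemma gradedComm_eq (s : smoothSections V F E) (x : Y) (v w : TangentSpace 𝓘(ℝ, V) x) :
    gradedComm T T' s x v w = bracket V F E x (hT.op x v) (hT'.op x w) s +
      bracket V F E x (hT'.op x v) (hT.op x w) s := by
  simp only [gradedComm, Pi.add_apply]
  rw [hT.comp_eq hT', hT'.comp_eq hT, bracket_apply, bracket_apply]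
  abel

include hT hT' in
lemma lincomb (c c' : ℂ) :
    IsFirstOrder F (c * a + c' * a') (c * b + c' * b') fun s x => c • T s x + c' • T' s x where
  smooth s hs x v := (smoothSections V F E).add_mem
    ((smoothSections V F E).smul_mem c (hT.smooth s hs x v))
    ((smoothSections V F E).smul_mem c' (hT'.smooth s hs x v))
  add s t hs ht := by
    funext x
    simp only [hT.add s t hs ht, hT'.add s t hs ht, Pi.add_apply, smul_add]
    abel
  leibniz f s hf hs x X := by
    simp only [_root_.add_apply, _root_.smul_apply]
    rw [hT.leibniz f s hf hs, hT'.leibniz f s hf hs]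
    module

include hT in
-- Locality: for a bump function χ at `y` supported where `s = t`, the section χ(s - t) is zero,
-- while at `y` the Leibniz rule gives T(χ(s - t)) = T(s - t), the derivative term dropping out as
-- `s - t` vanishes there.
lemma congr {s t : ∀ x, E x} (hs : IsSmoothSection V F s) (ht : IsSmoothSection V F t) {y : Y}
    (hst : ∀ᶠ z in 𝓝 y, s z = t z) : T s y = T t y := by
  obtain ⟨χ, -, hχ⟩ := (SmoothBumpFunction.nhds_basis_tsupport (I := 𝓘(ℝ, V)) y).mem_iff.1 hst
  have hu : IsSmoothSection V F (s - t) := (smoothSections V F E).sub_mem hs ht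
  have hf : ContMDiff 𝓘(ℝ, V) 𝓘(ℝ, ℂ) ∞ fun z => (χ z : ℂ) :=
    Complex.ofRealCLM.contDiff.comp_contMDiff χ.contMDiff
  have h0 : (fun z => (χ z : ℂ) • (s - t) z) = (0 : ℂ) • (s - t) := by
    funext z
    by_cases hz : z ∈ tsupport χ
    · have h2 : s z = t z := hχ hz
      simp [h2]
    · simp [image_eq_zero_of_notMem_tsupport hz]
  have h1 : T (s - t) y = 0 := by
    ext X
    have h2 := hT.leibniz _ (s - t) hf hu y X
    rw [h0, hT.smul_const 0 hu, χ.eq_one, Pi.sub_apply, hst.self_of_nhds] at h2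
    simpa using h2.symm
  have h2 := hT.add (s - t) t hu ht
  rw [sub_add_cancel] at h2
  rw [h2, Pi.add_apply, h1, zero_add]

end IsFirstOrder

/-- Holomorphy of the entries of the Jacobian between the charts at `x` and `y`. With ζ the
coordinate function, ∂̄ζ = 0 near `y`, so ∂̄_v (∂_w + ∂̄_w) ζ = ∂_w ∂̄_v ζ = 0 at `y`. -/
lemma delbar_derivOp_coordFun {x y : Y} (hxy : IsFlatNear (V := V) x y) (l : V →L[ℂ] ℂ)
    (v w : TangentSpace 𝓘(ℝ, V) x) :
    delbar (fun z => mvfderiv 𝓘(ℝ, V) (coordFun y l) z (coordField x w z)) y (coordField x v y)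
      = 0 := by
  let ζ : smoothFunctions V Y := ⟨coordFun y l, contMDiff_coordFun y l⟩
  have hζ : ∀ᶠ z in 𝓝 y, delbar (V := V) ζ.1 z = 0 := by
    filter_upwards [eventually_isFlatNear (V := V) y] with z hz using delbar_coordFun hz l
  have hloc : ∀ u, ∀ᶠ z in 𝓝 y, (delbarOp x u ζ).1 z = 0 := fun u => by
    filter_upwards [hζ] with z hz
    rw [delbarOp_apply, hz, _root_.zero_apply]
  have hder : ∀ (f : smoothFunctions V Y), (∀ᶠ z in 𝓝 y, f.1 z = 0) →
      mvfderiv 𝓘(ℝ, V) f.1 y = 0 := fun f hf => by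
    have h1 : f.1 =ᶠ[𝓝 y] fun _ => (0 : ℂ) := hf
    ext X
    exact congrArg (fun l => l X) ((hasMFDerivAt_const (I := 𝓘(ℝ, V)) (I' := 𝓘(ℝ, ℂ))
      (0 : ℂ) y).congr_of_eventuallyEq h1).mfderiv
  have h3 : derivOp x w = delOp x w + delbarOp x w := by
    rw [delOp, delbarOp]; module
  have h4 : delbar (fun z => mvfderiv 𝓘(ℝ, V) (coordFun y l) z (coordField x w z)) y
      (coordField x v y) = evalFun V y (delbarOp x v (derivOp x w ζ)) :=
    (delbarOp_apply x v (derivOp x w ζ) y).symm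
  rw [h4, h3, LinearMap.add_apply, map_add, map_add, ← delOp_delbarOp_comm hxy, evalFun_apply,
    evalFun_apply, delOp_apply, delbarOp_apply, del, delbar, hder _ (hloc v), hder _ (hloc w)]
  simp [part10_apply, part01_apply]

/-- Vanishing of the mixed brackets of a `(0,1)`-operator and a tensorial `(1,0)`-operator does not
depend on the choice of holomorphic coordinates. -/
lemma IsFirstOrder.bracket_eq_zero_of_isFlatNear {b : ℂ} {T Θ : (∀ x, E x) → Form1 V E}
    (hT : IsFirstOrder F 0 b T) (hΘ : IsFirstOrder F 0 0 Θ)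
    (hΘJ : ∀ s, IsSmoothSection V F s → ∀ x X, Θ s x (tangentJ x X) = Complex.I • Θ s x X)
    (hΘ0 : ∀ s t, IsSmoothSection V F s → IsSmoothSection V F t → ∀ x, s x = t x → Θ s x = Θ t x)
    {x y : Y} (hxy : IsFlatNear (V := V) x y)
    (h0 : ∀ v w s, bracket V F E y (hT.op y v) (hΘ.op y w) s = 0)
    (v w : TangentSpace 𝓘(ℝ, V) x) (s : smoothSections V F E) :
    bracket V F E y (hT.op x v) (hΘ.op x w) s = 0 := by
  let β := Module.finBasis ℂ V
  let e : Fin (Module.finrank ℂ V) → TangentSpace 𝓘(ℝ, V) y := fun i => (β i : V)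
  let c : Fin (Module.finrank ℂ V) → Y → ℂ := fun i z =>
    mvfderiv 𝓘(ℝ, V) (coordFun y (β.coord i).toContinuousLinearMap) z (coordField x w z)
  have hc : ∀ i, ContMDiff 𝓘(ℝ, V) 𝓘(ℝ, ℂ) ∞ (c i) := fun i =>
    contMDiff_mvfderiv_apply (contMDiff_coordFun y _) (contMDiff_coordField x w)
  -- Complex linearity of `Θ` lets the coordinate field of `x` be expanded in those of `y`, with the
  -- coefficients `c i`, on a whole neighbourhood of `y`.
  have hexp : ∀ u : smoothSections V F E, ∀ᶠ z in 𝓝 y, (hΘ.op x w u).1 z =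
      ∑ i, c i z • (hΘ.op y (e i) u).1 z := fun u => by
    filter_upwards [eventually_isFlatNear (V := V) y] with z hz
    exact apply_eq_sum_coordField hz (Θ u z) (hΘJ u u.2 z) β (coordField x w z)
  set X := coordField x v y with hX
  let τ : Fin (Module.finrank ℂ V) → smoothSections V F E := fun i =>
    ⟨fun z => c i z • (hΘ.op y (e i) s).1 z, IsSmoothSection.smul (hc i) (hΘ.op y (e i) s).2⟩
  have h1 : evalSec V F y (hT.op x v (hΘ.op x w s)) =
      ∑ i, c i y • evalSec V F y (hT.op y X (hΘ.op y (e i) s)) := by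
    have h2 : T (hΘ.op x w s).1 y = T (∑ i, τ i).1 y := by
      refine hT.congr (hΘ.op x w s).2 (∑ i, τ i).2 ?_
      filter_upwards [hexp s] with z hz
      rw [hz]
      simp [τ]
    have h3 : evalSec V F y (hT.op x v (hΘ.op x w s)) =
        evalSec V F y (hT.op y X (∑ i, τ i)) := by
      rw [hT.evalSec_op_self, ← h2]
      rfl
    rw [h3, map_sum, map_sum]
    refine Finset.sum_congr rfl fun i _ => ?_
    rw [hT.evalSec_op_self, hT.evalSec_op_self]
    have h4 := hT.leibniz (c i) _ (hc i) (hΘ.op y (e i) s).2 y X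
    -- The only derivative of the coefficient that enters is b ∂̄(c i), and it vanishes.
    rw [delbar_derivOp_coordFun hxy] at h4
    refine h4.trans ?_
    simp
  have h5 : evalSec V F y (hΘ.op x w (hT.op x v s)) =
      ∑ i, c i y • evalSec V F y (hΘ.op y (e i) (hT.op y X s)) := by
    refine (hexp _).self_of_nhds.trans (Finset.sum_congr rfl fun i _ => ?_)
    -- `Θ` is tensorial and the two sections have the same value at `y`, although they may differ
    -- elsewhere.
    have h6 : Θ (hT.op x v s).1 y = Θ (hT.op y X s).1 y :=
      hΘ0 _ _ (hT.op x v s).2 (hT.op y X s).2 y (hT.evalSec_op_self y X s).symm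
    have h7 : evalSec V F y (hΘ.op y (e i) (hT.op x v s)) =
        evalSec V F y (hΘ.op y (e i) (hT.op y X s)) := by
      rw [hΘ.evalSec_op, hΘ.evalSec_op, h6]
    exact congrArg _ h7
  rw [bracket_apply, h1, h5, ← Finset.sum_sub_distrib]
  refine Finset.sum_eq_zero fun i _ => ?_
  rw [← smul_sub, ← bracket_apply, h0, smul_zero]

/-! ### Adjoints with respect to the metric -/

/-- The pairing of smooth sections. -/
def HermitianMetric.pairing (h : HermitianMetric V F E) (s t : smoothSections V F E) :
    smoothFunctions V Y := ⟨fun y => h.inner y (s.1 y) (t.1 y), h.smooth s t s.2 t.2⟩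

lemma HermitianMetric.eval_pairing (h : HermitianMetric V F E) (x : Y)
    (s t : smoothSections V F E) :
    evalFun V x (h.pairing s t) = h.inner x (evalSec V F x s) (evalSec V F x t) := rfl

/-- The commutator of two operators is adjoint to the commutator of their adjoints. -/
lemma HermitianMetric.inner_bracket (h : HermitianMetric V F E)
    {A A' B B' : Module.End ℂ (smoothSections V F E)}
    {dA dB : smoothFunctions V Y →ₗ[ℂ] smoothFunctions V Y}
    (hA : ∀ s t, h.pairing (A s) t = dA (h.pairing s t) - h.pairing s (A' t))
    (hB : ∀ s t, h.pairing (B s) t = dB (h.pairing s t) - h.pairing s (B' t)) {x : Y}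
    (hd : ∀ f, evalFun V x (dA (dB f)) = evalFun V x (dB (dA f))) (s t : smoothSections V F E) :
    h.inner x (bracket V F E x A B s) (evalSec V F x t) =
      h.inner x (evalSec V F x s) (bracket V F E x B' A' t) := by
  rw [bracket_apply, bracket_apply]
  -- Each operator is moved to the other side at the cost of a derivative of the pairing. The terms
  -- with one derivative cancel in the commutator, and those with two cancel by `hd`.
  simp only [map_sub, LinearMap.sub_apply, ← h.eval_pairing, hA, hB]
  rw [hd]
  ring

lemma HermitianMetric.bracket_eq_zero (h : HermitianMetric V F E)
    {A A' B B' : Module.End ℂ (smoothSections V F E)}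
    {dA dB : smoothFunctions V Y →ₗ[ℂ] smoothFunctions V Y}
    (hA : ∀ s t, h.pairing (A s) t = dA (h.pairing s t) - h.pairing s (A' t))
    (hB : ∀ s t, h.pairing (B s) t = dB (h.pairing s t) - h.pairing s (B' t)) {x : Y}
    (hd : ∀ f, evalFun V x (dA (dB f)) = evalFun V x (dB (dA f)))
    (h0 : ∀ t, bracket V F E x B' A' t = 0) : bracket V F E x A B = 0 := by
  ext s
  refine h.ext_left x fun w => ?_
  obtain ⟨t, rfl⟩ := evalSec_surjective (V := V) (F := F) x w
  rw [h.inner_bracket hA hB hd, h0]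
  simp

/-! ### The operators along coordinate fields -/

namespace LambdaConnection

variable {lam : ℂ} (D : LambdaConnection V F E lam) (h : HermitianMetric V F E)

/-- `d'` along a coordinate field. -/
def dprimeOp (x : Y) (v : TangentSpace 𝓘(ℝ, V) x) : Module.End ℂ (smoothSections V F E) :=
  D.isFirstOrder_dprime.op x v

/-- `d''` along a coordinate field. -/
def dbarOp (x : Y) (v : TangentSpace 𝓘(ℝ, V) x) : Module.End ℂ (smoothSections V F E) :=
  D.isFirstOrder_dbar.op x v

/-- `δ'` along a coordinate field. -/
def deltaPrimeOp (x : Y) (v : TangentSpace 𝓘(ℝ, V) x) : Module.End ℂ (smoothSections V F E) :=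
  (D.isFirstOrder_deltaPrime h).op x v

/-- `δ''` along a coordinate field. -/
def deltaDoublePrimeOp (x : Y) (v : TangentSpace 𝓘(ℝ, V) x) :
    Module.End ℂ (smoothSections V F E) :=
  (D.isFirstOrder_deltaDoublePrime h).op x v

section Types

variable (x : Y) (v : TangentSpace 𝓘(ℝ, V) x)

lemma dprimeOp_tangentJ : D.dprimeOp x (tangentJ x v) = Complex.I • D.dprimeOp x v := by
  ext s y
  change D.dprime s.1 y (coordField x (tangentJ x v) y) = Complex.I • D.dprime s.1 y (coordField x v y)
  rw [coordField_tangentJ, dprime_tangentJ]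

lemma dbarOp_tangentJ : D.dbarOp x (tangentJ x v) = -(Complex.I • D.dbarOp x v) := by
  ext s y
  change D.dbar s.1 y (coordField x (tangentJ x v) y) = -(Complex.I • D.dbar s.1 y (coordField x v y))
  rw [coordField_tangentJ, dbar_tangentJ]

lemma deltaPrimeOp_tangentJ :
    D.deltaPrimeOp h x (tangentJ x v) = Complex.I • D.deltaPrimeOp h x v := by
  ext s y
  change D.deltaPrime h s.1 y (coordField x (tangentJ x v) y) =
    Complex.I • D.deltaPrime h s.1 y (coordField x v y)
  rw [coordField_tangentJ, deltaPrime_tangentJ D h s.2]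

lemma deltaDoublePrimeOp_tangentJ :
    D.deltaDoublePrimeOp h x (tangentJ x v) = -(Complex.I • D.deltaDoublePrimeOp h x v) := by
  ext s y
  change D.deltaDoublePrime h s.1 y (coordField x (tangentJ x v) y) =
    -(Complex.I • D.deltaDoublePrime h s.1 y (coordField x v y))
  rw [coordField_tangentJ, deltaDoublePrime_tangentJ D h s.2]

lemma pairing_deltaPrimeOp (s t : smoothSections V F E) :
    h.pairing (D.deltaPrimeOp h x v s) t =
      delOp x v (h.pairing s t) - h.pairing s (D.dbarOp x v t) := by
  refine Subtype.ext (funext fun y => ?_)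
  have := D.deltaPrime_spec h s.2 y t t.2 (coordField x v y)
  change h.inner y (D.deltaPrime h s.1 y (coordField x v y)) (t.1 y) = (delOp x v _).1 y -
    h.inner y (s.1 y) (D.dbar t.1 y (coordField x v y))
  rw [delOp_apply]
  exact (sub_eq_of_eq_add this).symm

lemma smul_del_pairing (s t : smoothSections V F E) :
    lam • delOp x v (h.pairing t s) =
      h.pairing (D.dprimeOp x v t) s + h.pairing t (D.deltaDoublePrimeOp h x v s) := by
  refine Subtype.ext (funext fun y => ?_)
  have := D.deltaDoublePrime_spec h s.2 y t t.2 (coordField x v y)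
  change lam * (delOp x v _).1 y = _
  rw [delOp_apply]
  exact this

/-- Conjugating the defining identity moves δ'' into the first slot and turns λ∂ into conj(λ) ∂̄. -/
lemma pairing_deltaDoublePrimeOp (s t : smoothSections V F E) :
    h.pairing (D.deltaDoublePrimeOp h x v s) t =
      (conj lam • delbarOp x v) (h.pairing s t) - h.pairing s (D.dprimeOp x v t) := by
  have h1 := D.smul_del_pairing h x v s t
  refine Subtype.ext (funext fun y => ?_)
  have h2 := congrArg conj (congrFun (congrArg Subtype.val h1) y)
  change conj (lam * (delOp x v _).1 y) = conj (h.inner y ((D.dprimeOp x v t).1 y) (s.1 y) +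
    h.inner y (t.1 y) ((D.deltaDoublePrimeOp h x v s).1 y)) at h2
  change h.inner y ((D.deltaDoublePrimeOp h x v s).1 y) (t.1 y) =
    conj lam * (delbarOp x v _).1 y - h.inner y (s.1 y) ((D.dprimeOp x v t).1 y)
  rw [map_add, ← h.conj_symm, ← h.conj_symm, map_mul, delOp_apply] at h2
  have h3 : (h.pairing t s).1 = fun z => conj ((h.pairing s t).1 z) :=
    funext fun z => h.conj_symm z _ _
  rw [h3, del_conj (mdifferentiableAt_smoothFunctions _ y), Complex.conj_conj] at h2
  rw [delbarOp_apply, h2, add_sub_cancel_left]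

end Types

lemma exists_op_toFun : ∃ a b, ∃ hT : IsFirstOrder F a b D.toFun,
    ∀ (x : Y) (v : TangentSpace 𝓘(ℝ, V) x), hT.op x v = D.dprimeOp x v + D.dbarOp x v := by
  have key : D.toFun = fun s x => (1 : ℂ) • D.dprime s x + (1 : ℂ) • D.dbar s x := by
    funext s x
    ext X
    simp only [dprime, dbar, _root_.add_apply, _root_.smul_apply, part10_apply, part01_apply]
    module
  have hT := D.isFirstOrder_dprime.lincomb D.isFirstOrder_dbar 1 1
  rw [← key] at hT
  refine ⟨_, _, hT, fun x v => ?_⟩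
  ext s y
  change D.toFun s.1 y (coordField x v y) = D.dprime s.1 y (coordField x v y) +
    D.dbar s.1 y (coordField x v y)
  conv_lhs => rw [key]
  simp

lemma exists_op_dStar : ∃ a b, ∃ hT : IsFirstOrder F a b (D.dStar h),
    ∀ (x : Y) (v : TangentSpace 𝓘(ℝ, V) x),
      hT.op x v = D.deltaPrimeOp h x v - D.deltaDoublePrimeOp h x v := by
  have key : D.dStar h =
      fun s x => (1 : ℂ) • D.deltaPrime h s x + (-1 : ℂ) • D.deltaDoublePrime h s x := by
    funext s x
    simp only [dStar]
    module
  have hT := (D.isFirstOrder_deltaPrime h).lincomb (D.isFirstOrder_deltaDoublePrime h) 1 (-1)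
  rw [← key] at hT
  exact ⟨_, _, hT, fun x v => rfl⟩

lemma exists_op_dbarE : ∃ a b, ∃ hT : IsFirstOrder F a b (D.dbarE h),
    ∀ (x : Y) (v : TangentSpace 𝓘(ℝ, V) x), hT.op x v =
      (1 / (1 + (‖lam‖ : ℂ) ^ 2)) • (D.dbarOp x v + lam • D.deltaDoublePrimeOp h x v) := by
  have key : D.dbarE h = fun s x => (1 / (1 + (‖lam‖ : ℂ) ^ 2)) • D.dbar s x +
      (1 / (1 + (‖lam‖ : ℂ) ^ 2) * lam) • D.deltaDoublePrime h s x := by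
    funext s x
    simp only [dbarE]
    module
  have hT := D.isFirstOrder_dbar.lincomb (D.isFirstOrder_deltaDoublePrime h)
    (1 / (1 + (‖lam‖ : ℂ) ^ 2)) (1 / (1 + (‖lam‖ : ℂ) ^ 2) * lam)
  rw [← key] at hT
  exact ⟨_, _, hT, fun x v => rfl⟩

lemma exists_op_theta : ∃ a b, ∃ hT : IsFirstOrder F a b (D.theta h),
    ∀ (x : Y) (v : TangentSpace 𝓘(ℝ, V) x), hT.op x v =
      (1 / (1 + (‖lam‖ : ℂ) ^ 2)) • (D.dprimeOp x v - lam • D.deltaPrimeOp h x v) := by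
  have key : D.theta h = fun s x => (1 / (1 + (‖lam‖ : ℂ) ^ 2)) • D.dprime s x +
      (-(1 / (1 + (‖lam‖ : ℂ) ^ 2) * lam)) • D.deltaPrime h s x := by
    funext s x
    simp only [theta]
    module
  have hT := D.isFirstOrder_dprime.lincomb (D.isFirstOrder_deltaPrime h)
    (1 / (1 + (‖lam‖ : ℂ) ^ 2)) (-(1 / (1 + (‖lam‖ : ℂ) ^ 2) * lam))
  rw [← key] at hT
  exact ⟨_, _, hT, fun x v => rfl⟩

/-! ### Consequences of flatness and the components of G(h) -/

variable {D}

/-- D ∘ D = 0 only says that the sum of the four brackets vanishes. Rotating `v` and `w` by J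
separates them by type. -/
lemma IsFlat.bracket_eq_zero (hD : D.IsFlat) (x : Y) (v w : TangentSpace 𝓘(ℝ, V) x) :
    bracket V F E x (D.dprimeOp x v) (D.dprimeOp x w) = 0 ∧
    bracket V F E x (D.dprimeOp x v) (D.dbarOp x w) = 0 ∧
    bracket V F E x (D.dbarOp x v) (D.dprimeOp x w) = 0 ∧
    bracket V F E x (D.dbarOp x v) (D.dbarOp x w) = 0 := by
  obtain ⟨a, b, hT, hop⟩ := D.exists_op_toFun
  have h1 : ∀ v w, bracket V F E x (D.dprimeOp x v) (D.dprimeOp x w) +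
      bracket V F E x (D.dprimeOp x v) (D.dbarOp x w) +
      bracket V F E x (D.dbarOp x v) (D.dprimeOp x w) +
      bracket V F E x (D.dbarOp x v) (D.dbarOp x w) = 0 := by
    intro v w
    have h2 : bracket V F E x (hT.op x v) (hT.op x w) = 0 := by
      ext s
      rw [← hT.comp_self_eq, hD s s.2]
      rfl
    rw [hop, hop] at h2
    simp only [map_add, LinearMap.add_apply] at h2
    rw [← h2]
    abel
  have h2 := h1 (tangentJ x v) w
  have h3 := h1 v (tangentJ x w)
  have h4 := h1 (tangentJ x v) (tangentJ x w)
  simp only [dprimeOp_tangentJ, dbarOp_tangentJ, map_smul, bracket_neg_left, bracket_neg_right,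
    LinearMap.smul_apply, smul_neg, smul_smul, Complex.I_mul_I, neg_neg, neg_smul, one_smul] at h2 h3 h4
  refine eq_zero_of_types (h1 v w) ?_ ?_ ?_
  · rw [← h2]; abel
  · rw [← h3]; abel
  · rw [← h4]; abel

/-- Flatness passes to adjoints: δ' corresponds to d'' and δ'' to d', and the derivatives ∂ and ∂̄
of functions commute along coordinate fields. -/
lemma IsFlat.bracket_delta_eq_zero (hD : D.IsFlat) (x : Y) (v w : TangentSpace 𝓘(ℝ, V) x) :
    bracket V F E x (D.deltaPrimeOp h x v) (D.deltaPrimeOp h x w) = 0 ∧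
    bracket V F E x (D.deltaPrimeOp h x v) (D.deltaDoublePrimeOp h x w) = 0 ∧
    bracket V F E x (D.deltaDoublePrimeOp h x v) (D.deltaPrimeOp h x w) = 0 ∧
    bracket V F E x (D.deltaDoublePrimeOp h x v) (D.deltaDoublePrimeOp h x w) = 0 := by
  have hx := isFlatNear_self (V := V) x
  have hR := fun v => D.pairing_deltaPrimeOp h x v
  have hS := fun v => D.pairing_deltaDoublePrimeOp h x v
  have hf := fun v w => hD.bracket_eq_zero x v w
  refine ⟨h.bracket_eq_zero (hR v) (hR w) (delOp_comm hx v w) ?_,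
    h.bracket_eq_zero (hR v) (hS w) ?_ ?_, h.bracket_eq_zero (hS v) (hR w) ?_ ?_,
    h.bracket_eq_zero (hS v) (hS w) ?_ ?_⟩
  · simp [(hf w v).2.2.2]
  · simp [delOp_delbarOp_comm hx v w]
  · simp [(hf w v).2.1]
  · simp [delOp_delbarOp_comm hx w v]
  · simp [(hf w v).2.2.1]
  · simp [delbarOp_comm hx v w]
  · simp [(hf w v).1]

variable (D)

/-- The `(2,0)`-part of `G(h)`. -/
def G20 (x : Y) (v w : TangentSpace 𝓘(ℝ, V) x) : smoothSections V F E →ₗ[ℂ] E x :=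
  bracket V F E x (D.dprimeOp x v) (D.deltaPrimeOp h x w) +
    bracket V F E x (D.deltaPrimeOp h x v) (D.dprimeOp x w)

/-- The `(1,1)`-part of `G(h)`. -/
def G11 (x : Y) (v w : TangentSpace 𝓘(ℝ, V) x) : smoothSections V F E →ₗ[ℂ] E x :=
  bracket V F E x (D.dbarOp x v) (D.deltaPrimeOp h x w) +
    bracket V F E x (D.deltaPrimeOp h x v) (D.dbarOp x w) -
    bracket V F E x (D.dprimeOp x v) (D.deltaDoublePrimeOp h x w) -
    bracket V F E x (D.deltaDoublePrimeOp h x v) (D.dprimeOp x w)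

/-- The `(0,2)`-part of `G(h)`. -/
def G02 (x : Y) (v w : TangentSpace 𝓘(ℝ, V) x) : smoothSections V F E →ₗ[ℂ] E x :=
  -(bracket V F E x (D.dbarOp x v) (D.deltaDoublePrimeOp h x w) +
    bracket V F E x (D.deltaDoublePrimeOp h x v) (D.dbarOp x w))

lemma G_eq (s : smoothSections V F E) (x : Y) (v w : TangentSpace 𝓘(ℝ, V) x) :
    D.G h s x v w = D.G20 h x v w s + D.G11 h x v w s + D.G02 h x v w s := by
  obtain ⟨a, b, hT, hop⟩ := D.exists_op_toFun
  obtain ⟨a', b', hT', hop'⟩ := D.exists_op_dStar h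
  rw [G, hT.gradedComm_eq hT', hop, hop, hop', hop']
  simp only [G20, G11, G02, map_add, bracket_sub_left, bracket_sub_right, LinearMap.add_apply, LinearMap.sub_apply,
    LinearMap.neg_apply]
  abel

lemma G_part11 (s : smoothSections V F E) (x : Y) (v w : TangentSpace 𝓘(ℝ, V) x) :
    (D.G h s).part11 x v w = D.G11 h x v w s := by
  rw [Form2.part11, G_eq, G_eq]
  simp only [G20, G11, G02, dprimeOp_tangentJ, dbarOp_tangentJ, deltaPrimeOp_tangentJ,
    deltaDoublePrimeOp_tangentJ, map_smul, bracket_neg_left, bracket_neg_right, LinearMap.smul_apply,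
    LinearMap.neg_apply, LinearMap.add_apply, LinearMap.sub_apply, smul_neg, smul_smul,
    Complex.I_mul_I, neg_neg, neg_smul, one_smul]
  module

variable {D}

/-- The brackets of d'' with d' and of δ'' with δ' vanish by flatness; what is left carries one
factor λ, with opposite signs for the pairs (d'', δ') and (δ'', d'), exactly as in `G11`. -/
lemma IsFlat.gradedComm_dbarE_theta (hD : D.IsFlat) (s : smoothSections V F E) (x : Y)
    (v w : TangentSpace 𝓘(ℝ, V) x) :
    gradedComm (D.dbarE h) (D.theta h) s x v w =
      (-(1 / (1 + (‖lam‖ : ℂ) ^ 2)) ^ 2 * lam) • D.G11 h x v w s := by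
  obtain ⟨a, b, hT, hop⟩ := D.exists_op_dbarE h
  obtain ⟨a', b', hT', hop'⟩ := D.exists_op_theta h
  rw [hT.gradedComm_eq hT', hop, hop, hop', hop']
  obtain ⟨-, h1, h2, -⟩ := hD.bracket_eq_zero x v w
  obtain ⟨-, h3, h4, -⟩ := hD.bracket_delta_eq_zero h x v w
  simp only [G11, map_add, bracket_sub_left, bracket_sub_right, map_smul, LinearMap.add_apply, LinearMap.sub_apply,
    LinearMap.smul_apply, h1, h2, h3, h4, LinearMap.zero_apply]
  module

/-! ### θ as an End(E)-valued form, its adjoint, and the curvature of ∂̄_{E,h} -/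

variable (D)

/-- A multiple of `∂̄_{E,h}` along a coordinate field. -/
def scaledDbarOp (x : Y) (v : TangentSpace 𝓘(ℝ, V) x) : Module.End ℂ (smoothSections V F E) :=
  D.dbarOp x v + lam • D.deltaDoublePrimeOp h x v

/-- A multiple of `θ_{E,h}` along a coordinate field. -/
def scaledThetaOp (x : Y) (v : TangentSpace 𝓘(ℝ, V) x) : Module.End ℂ (smoothSections V F E) :=
  D.dprimeOp x v - lam • D.deltaPrimeOp h x v

/-- The adjoint of `scaledThetaOp`. -/
def scaledThetaAdjOp (x : Y) (v : TangentSpace 𝓘(ℝ, V) x) : Module.End ℂ (smoothSections V F E) :=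
  conj lam • D.dbarOp x v - D.deltaDoublePrimeOp h x v

/-- Both d' and λδ' contribute λ∂ of the pairing, so the derivative cancels in their difference and
the adjoint is an honest one. -/
lemma pairing_scaledThetaOp (x : Y) (v : TangentSpace 𝓘(ℝ, V) x) (s t : smoothSections V F E) :
    h.pairing (D.scaledThetaOp h x v s) t = h.pairing s (D.scaledThetaAdjOp h x v t) := by
  have h1 := D.smul_del_pairing h x v t s
  have h2 := D.pairing_deltaPrimeOp h x v s t
  refine Subtype.ext (funext fun y => ?_)
  have h3 := congrFun (congrArg Subtype.val h1) y
  have h4 := congrFun (congrArg Subtype.val h2) y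
  change lam * (delOp x v (h.pairing s t)).1 y = h.inner y ((D.dprimeOp x v s).1 y) (t.1 y) +
    h.inner y (s.1 y) ((D.deltaDoublePrimeOp h x v t).1 y) at h3
  change h.inner y ((D.deltaPrimeOp h x v s).1 y) (t.1 y) = (delOp x v (h.pairing s t)).1 y -
    h.inner y (s.1 y) ((D.dbarOp x v t).1 y) at h4
  change h.inner y ((D.dprimeOp x v s).1 y - lam • (D.deltaPrimeOp h x v s).1 y) (t.1 y) =
    h.inner y (s.1 y) (conj lam • (D.dbarOp x v t).1 y - (D.deltaDoublePrimeOp h x v t).1 y)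
  simp only [map_sub, LinearMap.sub_apply, map_smul, LinearMap.smul_apply, LinearMap.map_smulₛₗ,
    Complex.conj_conj, smul_eq_mul]
  linear_combination -h3 - lam * h4

lemma inner_scaledThetaOp (x : Y) (v : TangentSpace 𝓘(ℝ, V) x) (s t : smoothSections V F E) :
    h.inner x (evalSec V F x (D.scaledThetaOp h x v s)) (evalSec V F x t) =
      h.inner x (evalSec V F x s) (evalSec V F x (D.scaledThetaAdjOp h x v t)) :=
  congrFun (congrArg Subtype.val (D.pairing_scaledThetaOp h x v s t)) x

/-- An operator with a pointwise adjoint is tensorial: if `s` vanishes at `x`, the image of `s` is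
orthogonal at `x` to everything. -/
lemma exists_scaledTheta_end (x : Y) (v : TangentSpace 𝓘(ℝ, V) x) :
    ∃ a a' : E x →ₗ[ℂ] E x,
      (∀ s, a (evalSec V F x s) = evalSec V F x (D.scaledThetaOp h x v s)) ∧
      (∀ s, a' (evalSec V F x s) = evalSec V F x (D.scaledThetaAdjOp h x v s)) ∧
      ∀ u w, h.inner x (a u) w = h.inner x u (a' w) := by
  have hs := evalSec_surjective (V := V) (F := F) (E := E) x
  obtain ⟨a, ha⟩ := exists_factor hs (evalSec V F x ∘ₗ D.scaledThetaOp h x v) fun s h0 => by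
    refine h.ext_left x fun w => ?_
    obtain ⟨t, rfl⟩ := hs w
    rw [LinearMap.comp_apply, inner_scaledThetaOp, h0]
    simp
  obtain ⟨a', ha'⟩ := exists_factor hs (evalSec V F x ∘ₗ D.scaledThetaAdjOp h x v) fun s h0 => by
    refine h.ext_left x fun w => ?_
    obtain ⟨t, rfl⟩ := hs w
    rw [h.conj_symm x (evalSec V F x t), LinearMap.comp_apply, ← inner_scaledThetaOp, h0]
    simp
  refine ⟨a, a', ha, ha', fun u w => ?_⟩
  obtain ⟨s, rfl⟩ := hs u
  obtain ⟨t, rfl⟩ := hs w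
  rw [ha, ha']
  exact D.inner_scaledThetaOp h x v s t

variable {D}

lemma IsFlat.bracket_scaledThetaOp (hD : D.IsFlat) (x : Y) (v w : TangentSpace 𝓘(ℝ, V) x) :
    bracket V F E x (D.scaledThetaOp h x v) (D.scaledThetaOp h x w) = -lam • D.G20 h x v w := by
  simp only [scaledThetaOp, G20, bracket_sub_left, bracket_sub_right, map_smul,
    LinearMap.smul_apply, (hD.bracket_eq_zero x v w).1, (hD.bracket_delta_eq_zero h x v w).1]
  module

lemma IsFlat.bracket_scaledThetaAdjOp (hD : D.IsFlat) (x : Y) (v w : TangentSpace 𝓘(ℝ, V) x) :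
    bracket V F E x (D.scaledThetaAdjOp h x v) (D.scaledThetaAdjOp h x w) =
      conj lam • D.G02 h x v w := by
  simp only [scaledThetaAdjOp, G02, bracket_sub_left, bracket_sub_right, map_smul,
    LinearMap.smul_apply, (hD.bracket_eq_zero x v w).2.2.2,
    (hD.bracket_delta_eq_zero h x v w).2.2.2]
  module

/-- Together with `IsFlat.bracket_scaledThetaAdjOp` this makes the curvature of ∂̄_{E,h}
proportional to the commutator of the adjoints of θ, which is what links analysis to linear algebra.
-/
lemma IsFlat.bracket_scaledDbarOp (hD : D.IsFlat) (x : Y) (v w : TangentSpace 𝓘(ℝ, V) x) :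
    bracket V F E x (D.scaledDbarOp h x v) (D.scaledDbarOp h x w) = -lam • D.G02 h x v w := by
  simp only [scaledDbarOp, G02, map_add, LinearMap.add_apply, map_smul,
    LinearMap.smul_apply, (hD.bracket_eq_zero x v w).2.2.2,
    (hD.bracket_delta_eq_zero h x v w).2.2.2]
  module

/-- `G11` controls only the sum of two brackets. Replacing `v` by Jv multiplies one by -i and the
other by i, so each vanishes separately. -/
lemma IsFlat.bracket_scaledDbarOp_scaledThetaOp (hD : D.IsFlat) {x : Y}
    (h0 : ∀ v w, D.G11 h x v w = 0) (v w : TangentSpace 𝓘(ℝ, V) x) :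
    bracket V F E x (D.scaledDbarOp h x v) (D.scaledThetaOp h x w) = 0 := by
  have h1 : ∀ v w, bracket V F E x (D.scaledDbarOp h x v) (D.scaledThetaOp h x w) +
      bracket V F E x (D.scaledThetaOp h x v) (D.scaledDbarOp h x w) = 0 := fun v w => by
    have h2 : bracket V F E x (D.scaledDbarOp h x v) (D.scaledThetaOp h x w) +
      bracket V F E x (D.scaledThetaOp h x v) (D.scaledDbarOp h x w) = -lam • D.G11 h x v w := by
      obtain ⟨-, h1, h2, -⟩ := hD.bracket_eq_zero x v w
      obtain ⟨-, h3, h4, -⟩ := hD.bracket_delta_eq_zero h x v w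
      simp only [scaledDbarOp, scaledThetaOp, G11, map_add, bracket_sub_left, bracket_sub_right,
        map_smul, LinearMap.smul_apply, LinearMap.add_apply, h1, h2, h3, h4]
      module
    rw [h2, h0, smul_zero]
  have hB : D.scaledDbarOp h x (tangentJ x v) = -(Complex.I • D.scaledDbarOp h x v) := by
    rw [scaledDbarOp, scaledDbarOp, dbarOp_tangentJ, deltaDoublePrimeOp_tangentJ]
    module
  have hΘ : D.scaledThetaOp h x (tangentJ x v) = Complex.I • D.scaledThetaOp h x v := by
    rw [scaledThetaOp, scaledThetaOp, dprimeOp_tangentJ, deltaPrimeOp_tangentJ]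
    module
  have h2 := h1 v w
  have h3 := h1 (tangentJ x v) w
  rw [hB, hΘ] at h3
  simp only [bracket_neg_left, map_smul, LinearMap.smul_apply] at h3
  generalize bracket V F E x (D.scaledDbarOp h x v) (D.scaledThetaOp h x w) = p at *
  generalize bracket V F E x (D.scaledThetaOp h x v) (D.scaledDbarOp h x w) = q at *
  have h4 : p = (1 / 2 : ℂ) • ((p + q) + Complex.I • (-(Complex.I • p) + Complex.I • q)) := by
    match_scalars <;> first | linear_combination (1 / 2 : ℂ) * Complex.I_sq |
      linear_combination -(1 / 2 : ℂ) * Complex.I_sq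
  rw [h4, h2, h3]
  simp

/-- If `G(h)^{1,1} = 0`, then the curvature of `∂̄_{E,h}` commutes with `θ_{E,h}`. -/
lemma IsFlat.bracket_scaledDbarOp_apply_scaledThetaOp (hD : D.IsFlat)
    (h0 : ∀ (x : Y) (v w : TangentSpace 𝓘(ℝ, V) x), D.G11 h x v w = 0) {x : Y}
    (v w u : TangentSpace 𝓘(ℝ, V) x) {a : E x →ₗ[ℂ] E x}
    (ha : ∀ s, a (evalSec V F x s) = evalSec V F x (D.scaledThetaOp h x u s))
    (s : smoothSections V F E) :
    bracket V F E x (D.scaledDbarOp h x v) (D.scaledDbarOp h x w) (D.scaledThetaOp h x u s) =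
      a (bracket V F E x (D.scaledDbarOp h x v) (D.scaledDbarOp h x w) s) := by
  have hB : ∃ b, ∃ hT : IsFirstOrder F 0 b
      (fun s x => (1 : ℂ) • D.dbar s x + lam • D.deltaDoublePrime h s x),
      ∀ (x : Y) v, hT.op x v = D.scaledDbarOp h x v := by
    have hT := D.isFirstOrder_dbar.lincomb (D.isFirstOrder_deltaDoublePrime h) 1 lam
    rw [show (1 : ℂ) * 0 + lam * 0 = 0 by ring] at hT
    refine ⟨_, hT, fun x v => ?_⟩
    rw [scaledDbarOp, ← one_smul ℂ (D.dbarOp x v)]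
    rfl
  have hΘ : ∃ hT : IsFirstOrder F 0 0
      (fun s x => (1 : ℂ) • D.dprime s x + (-lam) • D.deltaPrime h s x),
      ∀ (x : Y) v, hT.op x v = D.scaledThetaOp h x v := by
    have hT := D.isFirstOrder_dprime.lincomb (D.isFirstOrder_deltaPrime h) 1 (-lam)
    -- The symbols λ∂ of d' and of λδ' cancel, so Θ has symbol zero.
    rw [show (1 : ℂ) * lam + -lam * 1 = 0 by ring, show (1 : ℂ) * 0 + -lam * 0 = 0 by ring] at hT
    refine ⟨hT, fun x v => ?_⟩
    have h1 : D.scaledThetaOp h x v =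
        (1 : ℂ) • D.dprimeOp x v + (-lam) • D.deltaPrimeOp h x v := by
      rw [scaledThetaOp]; module
    rw [h1]
    rfl
  obtain ⟨b, hB, hBop⟩ := hB
  obtain ⟨hΘ, hΘop⟩ := hΘ
  -- One more operator will be applied to this identity, so it is required near `x`, always along
  -- the coordinate fields centred at `x`.
  have hnear : ∀ᶠ y in 𝓝 x, ∀ v w, bracket V F E y (D.scaledDbarOp h x v)
      (D.scaledThetaOp h x w) = 0 := by
    filter_upwards [eventually_isFlatNear (V := V) x] with y hxy v w
    ext s
    rw [← hBop, ← hΘop]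
    refine hB.bracket_eq_zero_of_isFlatNear hΘ ?_ ?_ hxy ?_ v w s
    · intro s hs x X
      simp only [_root_.add_apply, _root_.smul_apply, dprime_tangentJ,
        deltaPrime_tangentJ D h hs]
      module
    · intro s t hs ht z hst
      ext X
      obtain ⟨a, -, ha, -⟩ := D.exists_scaledTheta_end h z X
      have h1 := ha ⟨s, hs⟩
      have h2 := ha ⟨t, ht⟩
      rw [← hΘop, hΘ.evalSec_op_self] at h1 h2
      rw [← h1, ← h2]
      exact congrArg a hst
    · intro v w s
      rw [hBop, hΘop, hD.bracket_scaledDbarOp_scaledThetaOp h (h0 y)]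
      rfl
  have hcomm : ∀ v w s, evalSec V F x (D.scaledDbarOp h x v (D.scaledThetaOp h x w s)) =
      evalSec V F x (D.scaledThetaOp h x w (D.scaledDbarOp h x v s)) := fun v w s => by
    rw [← sub_eq_zero, ← bracket_apply, hnear.self_of_nhds]
    rfl
  -- Θ_u is first commuted past the inner operator B_w, as an identity of sections near `x` to which
  -- B_v applies by locality, and then past B_v at `x` itself.
  have hswap : ∀ v w, evalSec V F x (D.scaledDbarOp h x v (D.scaledDbarOp h x w
      (D.scaledThetaOp h x u s))) =
      a (evalSec V F x (D.scaledDbarOp h x v (D.scaledDbarOp h x w s))) := by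
    intro v w
    rw [ha, ← hcomm, ← hBop x v, hB.evalSec_op_self, hB.evalSec_op_self]
    refine congrArg (fun l => l v) (hB.congr (Subtype.property _) (Subtype.property _) ?_)
    filter_upwards [hnear] with y hy
    have h1 := LinearMap.congr_fun (hy w u) s
    rw [bracket_apply] at h1
    exact sub_eq_zero.1 h1
  rw [bracket_apply, bracket_apply, hswap, hswap, map_sub]

/-- The commutator of the adjoints of Θ_v and Θ_w is conj(λ) `G02` and the curvature of B is -λ
`G02`. After division by λ, the commutation of the curvature with Θ is the hypothesis of
`commute_of_commute_adjoint_commutator`. -/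
lemma IsFlat.G20_G02_eq_zero (hlam : lam ≠ 0) (hD : D.IsFlat)
    (h0 : ∀ (x : Y) (v w : TangentSpace 𝓘(ℝ, V) x), D.G11 h x v w = 0) (x : Y)
    (v w : TangentSpace 𝓘(ℝ, V) x) : D.G20 h x v w = 0 ∧ D.G02 h x v w = 0 := by
  have hs := evalSec_surjective (V := V) (F := F) (E := E) x
  have : FiniteDimensional ℂ (E x) :=
    ((trivializationAt F E x).linearEquivAt ℂ x
      (FiberBundle.mem_baseSet_trivializationAt' x)).symm.finiteDimensional
  obtain ⟨a, a', ha, ha', haa⟩ := D.exists_scaledTheta_end h x v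
  obtain ⟨c, c', hc, hc', hcc⟩ := D.exists_scaledTheta_end h x w
  have hm : ∀ s, a' (c' (evalSec V F x s)) - c' (a' (evalSec V F x s)) =
      conj lam • D.G02 h x v w s := fun s => by
    rw [hc', ha', ha', hc', ← bracket_apply, hD.bracket_scaledThetaAdjOp]
    rfl
  have hG : ∀ u (b : E x →ₗ[ℂ] E x),
      (∀ s, b (evalSec V F x s) = evalSec V F x (D.scaledThetaOp h x u s)) →
      ∀ e, b (a' (c' e) - c' (a' e)) = a' (c' (b e)) - c' (a' (b e)) := by
    intro u b hb e
    obtain ⟨s, rfl⟩ := hs e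
    have h1 := hD.bracket_scaledDbarOp_apply_scaledThetaOp h h0 v w u hb s
    rw [hD.bracket_scaledDbarOp, LinearMap.smul_apply, LinearMap.smul_apply, map_smul] at h1
    have h2 := smul_right_injective (E x) (neg_ne_zero.2 hlam) h1
    rw [hm, hb, hm, map_smul, h2]
  obtain ⟨h1, h2⟩ := commute_of_commute_adjoint_commutator (h.inner x) (h.conj_symm x) (h.pos x)
    haa hcc (hG v a ha) (hG w c hc)
  constructor
  · ext s
    have h3 := h1 (evalSec V F x s)
    rw [hc, ha, ha, hc, ← sub_eq_zero, ← bracket_apply, hD.bracket_scaledThetaOp] at h3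
    exact (smul_eq_zero.1 h3).resolve_left (neg_ne_zero.2 hlam)
  · ext s
    have h3 := hm s
    rw [h2, sub_self] at h3
    exact (smul_eq_zero.1 h3.symm).resolve_left (by simpa using hlam)

variable (D)

lemma g11Vanishes_iff :
    D.G11Vanishes h ↔ ∀ (x : Y) (v w : TangentSpace 𝓘(ℝ, V) x), D.G11 h x v w = 0 := by
  constructor
  · intro h0 x v w
    ext s
    rw [← D.G_part11, h0 s s.2]
    rfl
  · intro h0 s hs
    funext x v w
    rw [D.G_part11 h ⟨s, hs⟩, h0]
    rfl

variable {D}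

lemma IsFlat.dbarThetaVanishes_iff (hlam : lam ≠ 0) (hD : D.IsFlat) :
    D.DbarThetaVanishes h ↔ ∀ (x : Y) (v w : TangentSpace 𝓘(ℝ, V) x), D.G11 h x v w = 0 := by
  constructor
  · intro h0 x v w
    ext s
    have h1 := hD.gradedComm_dbarE_theta h s x v w
    rw [h0 s s.2] at h1
    have h2 : (1 + (‖lam‖ : ℂ) ^ 2) ≠ 0 := by
      norm_cast
      positivity
    refine (smul_eq_zero.1 h1.symm).resolve_left ?_
    simp [hlam, h2]
  · intro h0 s hs
    funext x v w
    rw [hD.gradedComm_dbarE_theta h ⟨s, hs⟩, h0]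
    simp

lemma IsFlat.isPluriharmonic_iff (hlam : lam ≠ 0) (hD : D.IsFlat) :
    D.IsPluriharmonic h ↔ D.G11Vanishes h := by
  constructor
  · intro h0 s hs
    rw [h0 s hs]
    funext x v w
    simp [Form2.part11]
  · intro h0 s hs
    rw [g11Vanishes_iff] at h0
    funext x v w
    obtain ⟨h1, h2⟩ := hD.G20_G02_eq_zero h hlam h0 x v w
    rw [D.G_eq h ⟨s, hs⟩, h0, h1, h2]
    simp

end LambdaConnection

end LambdaFlat

end

theorem mainTheorem8
    {V : Type*} [NormedAddCommGroup V] [NormedSpace ℂ V] [FiniteDimensional ℂ V]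
    {Y : Type*} [TopologicalSpace Y] [T2Space Y] [ChartedSpace V Y] [IsManifold 𝓘(ℂ, V) ω Y]
    {F : Type*} [NormedAddCommGroup F] [NormedSpace ℂ F] [FiniteDimensional ℂ F]
    {E : Y → Type*} [∀ x, AddCommGroup (E x)] [∀ x, Module ℂ (E x)]
    [∀ x, TopologicalSpace (E x)] [∀ x, IsTopologicalAddGroup (E x)]
    [∀ x, ContinuousSMul ℂ (E x)]
    [TopologicalSpace (TotalSpace F E)] [FiberBundle F E] [VectorBundle ℂ F E]
    [ContMDiffVectorBundle ∞ F E 𝓘(ℝ, V)]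
    {lam : ℂ} (hlam : lam ≠ 0)
    (D : LambdaFlat.LambdaConnection V F E lam) (hD : D.IsFlat)
    (h : LambdaFlat.HermitianMetric V F E) :
    (D.G11Vanishes h → D.IsPluriharmonic h) ∧
      (D.IsPluriharmonic h ↔ D.G11Vanishes h) ∧
      (D.IsPluriharmonic h ↔ D.DbarThetaVanishes h) := by
  rw [hD.isPluriharmonic_iff h hlam, hD.dbarThetaVanishes_iff h hlam, ← D.g11Vanishes_iff h]
  exact ⟨id, Iff.rfl, Iff.rfl⟩
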